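/- **Conventions.** For $d\ge 1$ let $\mathcal P_d(\mathbb R)$ be the set of monic real-rooted polynomials of degree $d$. Write a monic polynomial of degree $d$ as $p(x)=\sum_{k=0}^d x^{d-k}(-1)^k\binom dk \tilde a_k(p)$. The finite free multiplicative convolution is $[p\boxtimes_d q](x)=\sum_{k=0}^d x^{d-k}(-1)^k\binom dk\,\tilde a_k(p)\tilde a_k(q)$; the finite free cumulants are $$\kappa_n(p)=\frac{(-d)^{n-1}}{(n-1)!}\sum_{\pi\in P(n)}(-1)^{|\pi|-1}(|\pi|-1)!\prod_{V\in\pi}\tilde a_{|V|}(p)\qquad(1\le n\le d),$$ with $P(n)$ the set of partitions of $[n]=\{1,\dots,n\}$; and $m_n(p)=\frac1d\sum_{i=1}^d\lambda_i^n$, where $\lambda_1,\dots,\lambda_d$ are the complex roots of $p$ with multiplicity. For a sequence $u=(u_n)_{n\ge1}$ and a partition $\pi$ put $u_\pi=\prod_{V\in\pi}u_{|V|}$ and $u_{\pi\setminus V}=\prod_{W\in\pi,W\ne V}u_{|W|}$; for a permutation $\sigma$, $u_\sigma$ is the product of $u_{|c|}$ over its cycles $c$ (fixed points included). $NC(n)$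 is the set of non-crossing partitions of $[n]$. For $\pi\in NC(n)$, regarded also as the permutation whose cycles are its blocks in increasing order, $Kr(\pi)$ is the partition of $[n]$ into cycles of $\pi^{-1}\gamma_n$, $\gamma_n=(1,2,\dots,n)$. For $t,s\ge1$ let $\gamma_{t,s}=(1,\dots,t)(t+1,\dots,t+s)$, let $S_{NC}(t,s)$ be the set of $\sigma\in S_{t+s}$ such that $\langle\sigma,\gamma_{t,s}\rangle$ is transitive on $[t+s]$ and the numbers of cycles of $\sigma$ and $\sigma^{-1}\gamma_{t,s}$ add up to $t+s$, and put $Kr_{t,s}(\sigma)=\sigma^{-1}\gamma_{t,s}$. The free cumulants $r_n(\mu)$ of a moment sequence $(m_n(\mu))$ are determined by $m_n(\mu)=\sum_{\pi\in NC(n)}r_\pi(\mu)$, $n\ge1$. The free multiplicative convolution $\mu\boxtimes\nu$ is the distribution (moment sequence) with free cumulants $r_n(\mu\boxtimes\nu)=\sum_{\pi\in NC(n)}r_\pi(\mu)\,r_{Kr(\pi)}(\nu)$, $n\ge 1$. A sequence $\mathfrak p=(p_d)_{d\ge1}$ with $p_d$ monic of degree $d$ has infinitesimal distribution $(\mu,\mu')$,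 where $\mu$ is a probability measure on $\mathbb R$ with finite moments $m_n(\mu)$ of all orders and $\mu':\mathbb R[x]\to\mathbb R$ is linear, if $m_n(p_d)\to m_n(\mu)$ and $d\,(m_n(p_d)-m_n(\mu))\to\mu'(x^n)$ as $d\to\infty$ for all $n\ge0$. Its cumulant fluctuations are the numbers $\widehat r_n(\mathfrak p)$, $n\ge1$, with $\kappa_n(p_d)=r_n(\mu)+\frac1d\widehat r_n(\mathfrak p)+o(1/d)$. **Theorem.** Let $\mathfrak p=(p_d)_{d\ge1}$ and $\mathfrak q=(q_d)_{d\ge1}$ with $p_d,q_d\in\mathcal P_d(\mathbb R)$ have infinitesimal distributions $(\mu,\mu')$ and $(\nu,\nu')$. Then the cumulant fluctuations $\widehat r_n(\mathfrak p)$ and $\widehat r_n(\mathfrak q)$ exist, and for every $n\ge1$, as $d\to\infty$, $$\kappa_n(p_d\boxtimes_d q_d)=r_n(\mu\boxtimes\nu)+\frac1d\,\widehat r_n(\mathfrak p\boxtimes\mathfrak q)+o(1/d),$$ where $$\widehat r_n(\mathfrak p\boxtimes\mathfrak q)=\sum_{\pi\in NC(n)}\Big(\sum_{V\in\pi}\widehat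 r_{|V|}(\mathfrak p)\,r_{\pi\setminus V}(\mu)\,r_{Kr(\pi)}(\nu)+\sum_{W\in Kr(\pi)}r_\pi(\mu)\,\widehat r_{|W|}(\mathfrak q)\,r_{Kr(\pi)\setminus W}(\nu)\Big)-\frac n2\sum_{\substack{t+s=n,\ t,s\ge1\\ \sigma\in S_{NC}(t,s)}}\frac{r_\sigma(\mu)\,r_{Kr_{t,s}(\sigma)}(\nu)}{ts}.$$ Consequently $\mathfrak p\boxtimes\mathfrak q=(p_d\boxtimes_d q_d)_{d\ge1}$ has infinitesimal moments of all orders: for every $n\ge1$, $$\lim_{d\to\infty}d\,\big(m_n(p_d\boxtimes_d q_d)-m_n(\mu\boxtimes\nu)\big)=\sum_{\pi\in NC(n)}\sum_{V\in\pi}\widehat r_{|V|}(\mathfrak p\boxtimes\mathfrak q)\,r_{\pi\setminus V}(\mu\boxtimes\nu)-\frac n2\sum_{\substack{t+s=n,\ t,s\ge1\\ \sigma\in S_{NC}(t,s)}}\frac{r_\sigma(\mu\boxtimes\nu)}{ts}.$$ In particular, whenever a probability measure $\tau$ on $\mathbb R$ with finite moments of all orders satisfies $r_n(\tau)=r_n(\mu\boxtimes\nu)$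 for all $n\ge1$, the sequence $\mathfrak p\boxtimes\mathfrak q$ has infinitesimal distribution $(\tau,\tau')$, with $\tau'(x^n)$ equal to the limit above for $n\ge 1$, and its cumulant fluctuations are the $\widehat r_n(\mathfrak p\boxtimes\mathfrak q)$. -/

import Mathlib

open Polynomial MeasureTheory Filter Topology
open scoped BigOperators

namespace FiniteFree

/-! ### Non-crossing partitions, Kreweras complements, annular non-crossing permutations -/

/-- Set partitions of `{0, …, n-1}` (standing for `[n] = {1, …, n}`). -/
abbrev SetPartition (n : ℕ) : Type := Finpartition (Finset.univ : Finset (Fin n))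

/-- A partition is non-crossing if `a < b < c < d`, `a, c ∈ V`, `b, d ∈ W` force `V = W`. -/
def IsNonCrossing {n : ℕ} (π : SetPartition n) : Prop :=
  ∀ V ∈ π.parts, ∀ W ∈ π.parts, ∀ a b c d : Fin n,
    a < b → b < c → c < d → a ∈ V → c ∈ V → b ∈ W → d ∈ W → V = W

open Classical in
/-- `NC(n)`, the set of non-crossing partitions of `[n]`. -/
noncomputable def NC (n : ℕ) : Finset (SetPartition n) :=
  Finset.univ.filter IsNonCrossing

/-- The cyclic permutation whose only nontrivial cycle is `V` written in increasing order. -/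
def blockCycle {n : ℕ} (V : Finset (Fin n)) : Equiv.Perm (Fin n) :=
  (V.sort (· ≤ ·)).formPerm

theorem blockCycle_mem {n : ℕ} {V : Finset (Fin n)} {a : Fin n} (h : a ∈ V) :
    blockCycle V a ∈ V := by
  have h2 : blockCycle V a ∈ V.sort (· ≤ ·) :=
    List.formPerm_apply_mem_of_mem (by simpa using h)
  simpa only [Finset.mem_sort] using h2

theorem blockCycle_symm_mem {n : ℕ} {V : Finset (Fin n)} {a : Fin n} (h : a ∈ V) :
    (blockCycle V).symm a ∈ V := by
  have h2 : (V.sort (· ≤ ·)).formPerm ((blockCycle V).symm a) ∈ V.sort (· ≤ ·) := by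
    simpa [blockCycle] using h
  simpa using List.mem_of_formPerm_apply_mem h2

theorem part_eq_of_mem_part {n : ℕ} (π : SetPartition n) {a b : Fin n} (h : b ∈ π.part a) :
    π.part b = π.part a :=
  π.part_eq_of_mem (π.part_mem.2 (Finset.mem_univ a)) h

/-- The permutation attached to a partition: its cycles are the blocks, each written in
increasing order. -/
def toPerm {n : ℕ} (π : SetPartition n) : Equiv.Perm (Fin n) where
  toFun a := blockCycle (π.part a) a
  invFun a := (blockCycle (π.part a)).symm a
  left_inv a := by
    have h := blockCycle_mem (π.mem_part (Finset.mem_univ a))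
    simp only [part_eq_of_mem_part π h, Equiv.symm_apply_apply]
  right_inv a := by
    have h := blockCycle_symm_mem (π.mem_part (Finset.mem_univ a))
    simp only [part_eq_of_mem_part π h, Equiv.apply_symm_apply]

open Classical in
/-- The partition attached to a permutation: its blocks are the cycles (orbits), fixed points
included. -/
noncomputable def cyclePartition {n : ℕ} (σ : Equiv.Perm (Fin n)) : SetPartition n :=
  Finpartition.ofSetoid (Equiv.Perm.SameCycle.setoid σ)

/-- The Kreweras complement `Kr(π)`: the partition of the permutation `π⁻¹ γ_n`, where
`γ_n = (1, 2, …, n)`. -/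
noncomputable def kreweras {n : ℕ} (π : SetPartition n) : SetPartition n :=
  cyclePartition ((toPerm π)⁻¹ * finRotate n)

/-- `γ_{t,s} = (1, …, t)(t+1, …, t+s)`. -/
def annularCycle (t s : ℕ) : Equiv.Perm (Fin (t + s)) :=
  finSumFinEquiv.permCongr (Equiv.sumCongr (finRotate t) (finRotate s))

open Classical in
/-- `S_NC(t,s)`, the annular non-crossing permutations: the group generated by `σ` and `γ_{t,s}`
acts transitively, and `|σ| + |σ⁻¹ γ_{t,s}| = t + s`, where `|·|` is the number of cycles. -/
noncomputable def annularNC (t s : ℕ) : Finset (Equiv.Perm (Fin (t + s))) :=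
  Finset.univ.filter fun σ =>
    MulAction.IsPretransitive
      (Subgroup.closure ({σ, annularCycle t s} : Set (Equiv.Perm (Fin (t + s))))) (Fin (t + s)) ∧
    (cyclePartition σ).parts.card + (cyclePartition (σ⁻¹ * annularCycle t s)).parts.card = t + s

/-- `u_π = ∏_{V ∈ π} u_{|V|}`. -/
def prodOver (u : ℕ → ℝ) {n : ℕ} (π : SetPartition n) : ℝ :=
  ∏ V ∈ π.parts, u V.card

/-- `∑_{V ∈ π} û_{|V|} u_{π ∖ V}`. -/
def derivOver (u u' : ℕ → ℝ) {n : ℕ} (π : SetPartition n) : ℝ :=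
  ∑ V ∈ π.parts, u' V.card * ∏ W ∈ π.parts.erase V, u W.card

/-- `(n/2) ∑_{t+s=n, t,s ≥ 1} ∑_{σ ∈ S_NC(t,s)} u_σ v_{Kr_{t,s}(σ)} / (ts)`, where
`Kr_{t,s}(σ) = σ⁻¹ γ_{t,s}`. -/
noncomputable def annularSum (u v : ℕ → ℝ) (n : ℕ) : ℝ :=
  (n : ℝ) / 2 *
    ∑ ts ∈ (Finset.HasAntidiagonal.antidiagonal n).filter (fun ts => 1 ≤ ts.1 ∧ 1 ≤ ts.2),
      ∑ σ ∈ annularNC ts.1 ts.2,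
        prodOver u (cyclePartition σ) *
          prodOver v (cyclePartition (σ⁻¹ * annularCycle ts.1 ts.2)) /
            ((ts.1 : ℝ) * (ts.2 : ℝ))

/-! ### Free cumulants and free multiplicative convolution -/

/-- The free cumulants `r_n` of a moment sequence `m`, through the recursion
`r_n = m_n - ∑_{π ∈ NC(n), π ≠ 1_n} r_π`: the summand of the one-block partition is `0` below.
The value at `n = 0` is irrelevant. -/
noncomputable def freeCumulant (m : ℕ → ℝ) (n : ℕ) : ℝ :=
  m n - ∑ π ∈ NC n, ∏ V ∈ π.parts, if V.card < n then freeCumulant m V.card else 0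

theorem card_lt_of_ne {n : ℕ} (hn : 1 ≤ n) (π : SetPartition n)
    (h : π ≠ Finpartition.indiscrete (Finset.univ_nonempty_iff.2 ⟨⟨0, hn⟩⟩).ne_empty) :
    ∀ V ∈ π.parts, V.card < n := by
  intro V hV
  by_contra hlt
  have hVu : V = Finset.univ := by
    apply Finset.eq_univ_of_card
    have := Finset.card_le_univ V
    simp only [Fintype.card_fin] at *
    omega
  apply h
  ext W
  simp only [Finpartition.indiscrete_parts, Finset.mem_singleton]
  constructor
  · intro hW
    obtain ⟨x, hx⟩ := π.nonempty_of_mem_parts hW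
    rw [← π.part_eq_of_mem hW hx]
    exact (π.part_eq_of_mem hV (by simp [hVu])).trans hVu
  · rintro rfl
    exact hVu ▸ hV

theorem sum_NC_split (u : ℕ → ℝ) {n : ℕ} (hn : 1 ≤ n) :
    ∑ π ∈ NC n, prodOver u π =
      u n + ∑ π ∈ NC n, ∏ V ∈ π.parts, if V.card < n then u V.card else 0 := by
  classical
  set I : SetPartition n :=
    Finpartition.indiscrete (Finset.univ_nonempty_iff.2 ⟨⟨0, hn⟩⟩).ne_empty with hI
  have hIparts : I.parts = {Finset.univ} := rfl
  have hmem : I ∈ NC n := by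
    simp only [NC, Finset.mem_filter, Finset.mem_univ, true_and]
    intro V hV W hW
    rw [hIparts, Finset.mem_singleton] at hV hW
    intros
    rw [hV, hW]
  rw [← Finset.add_sum_erase _ _ hmem, ← Finset.add_sum_erase (a := I) _ _ hmem]
  have h1 : prodOver u I = u n := by simp [prodOver, hIparts]
  have h2 : (∏ V ∈ I.parts, if V.card < n then u V.card else 0) = 0 := by simp [hIparts]
  rw [h1, h2, zero_add]
  congr 1
  refine Finset.sum_congr rfl fun π hπ => Finset.prod_congr rfl fun V hV => ?_
  rw [if_pos (card_lt_of_ne hn π (Finset.ne_of_mem_erase hπ) V hV)]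

/-- The moment-cumulant formula `m_n = ∑_{π ∈ NC(n)} r_π`. -/
theorem moment_eq_sum_freeCumulant (m : ℕ → ℝ) {n : ℕ} (hn : 1 ≤ n) :
    m n = ∑ π ∈ NC n, prodOver (freeCumulant m) π := by
  rw [sum_NC_split _ hn, freeCumulant]
  simp

/-- The moment-cumulant formula determines the free cumulants. -/
theorem freeCumulant_unique (m r : ℕ → ℝ)
    (h : ∀ n, 1 ≤ n → m n = ∑ π ∈ NC n, prodOver r π) :
    ∀ n, 1 ≤ n → r n = freeCumulant m n := by
  intro n
  induction n using Nat.strong_induction_on with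
  | _ n ih =>
    intro hn
    have e := h n hn
    rw [sum_NC_split _ hn] at e
    rw [freeCumulant, e, eq_comm, sub_eq_iff_eq_add]
    congr 1
    refine Finset.sum_congr rfl fun π _ => Finset.prod_congr rfl fun V hV => ?_
    by_cases hlt : V.card < n
    · rw [if_pos hlt, if_pos hlt]
      exact ih _ hlt (Finset.card_pos.2 (π.nonempty_of_mem_parts hV))
    · rw [if_neg hlt, if_neg hlt]

/-- `∑_{π ∈ NC(n)} r_π(μ) r_{Kr(π)}(ν)`, for moment sequences `m` of `μ` and `k` of `ν`. -/
noncomputable def freeMulConvCumulant (m k : ℕ → ℝ) (n : ℕ) : ℝ :=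
  ∑ π ∈ NC n, prodOver (freeCumulant m) π * prodOver (freeCumulant k) (kreweras π)

/-- The moment sequence of the free multiplicative convolution `μ ⊠ ν`, from the moment sequences
`m` of `μ` and `k` of `ν`: the one whose free cumulants are `freeMulConvCumulant m k`. -/
noncomputable def freeMulConv (m k : ℕ → ℝ) (n : ℕ) : ℝ :=
  ∑ π ∈ NC n, prodOver (freeMulConvCumulant m k) π

theorem freeCumulant_freeMulConv (m k : ℕ → ℝ) {n : ℕ} (hn : 1 ≤ n) :
    freeCumulant (freeMulConv m k) n = freeMulConvCumulant m k n :=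
  (freeCumulant_unique (freeMulConv m k) (freeMulConvCumulant m k) (fun _ _ => rfl) n hn).symm

/-- The moments `m_n(μ) = ∫ tⁿ dμ(t)`. -/
noncomputable def moments (μ : Measure ℝ) (n : ℕ) : ℝ := ∫ t, t ^ n ∂μ

/-- A probability measure on `ℝ` with finite moments of all orders. -/
def IsProbWithMoments (μ : Measure ℝ) : Prop :=
  IsProbabilityMeasure μ ∧ ∀ n : ℕ, Integrable (fun t : ℝ => t ^ n) μ

/-- The probability measure `τ` is a free multiplicative convolution `μ ⊠ ν`:
`r_n(τ) = ∑_{π ∈ NC(n)} r_π(μ) r_{Kr(π)}(ν)` for all `n ≥ 1`. -/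
def IsFreeMulConv (μ ν τ : Measure ℝ) : Prop :=
  IsProbWithMoments τ ∧
    ∀ n, 1 ≤ n → freeCumulant (moments τ) n = freeMulConvCumulant (moments μ) (moments ν) n

/-! ### Finite free probability -/

/-- `P_d(ℝ)`: monic real-rooted polynomials of degree `d`. -/
def IsRealRooted (d : ℕ) (p : ℝ[X]) : Prop :=
  p.Monic ∧ p.natDegree = d ∧ p.Splits

/-- The coefficients `ã_k` in `p = ∑_{k=0}^d x^{d-k} (-1)^k (d choose k) ã_k`, `0 ≤ k ≤ d`. -/
noncomputable def normCoeff (d : ℕ) (p : ℝ[X]) (k : ℕ) : ℝ :=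
  (-1) ^ k * p.coeff (d - k) / (d.choose k : ℝ)

/-- The finite free multiplicative convolution `p ⊠_d q`. -/
noncomputable def mulConv (d : ℕ) (p q : ℝ[X]) : ℝ[X] :=
  ∑ k ∈ Finset.range (d + 1),
    C ((-1) ^ k * (d.choose k : ℝ) * (normCoeff d p k * normCoeff d q k)) * X ^ (d - k)

/-- The finite free cumulants of a polynomial of degree `d`:
`κ_n(p) = (-d)^{n-1}/(n-1)! ∑_{π ∈ P(n)} (-1)^{|π|-1} (|π|-1)! ∏_{V ∈ π} ã_{|V|}(p)`, `1 ≤ n ≤ d`. -/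
noncomputable def finiteCumulant (d : ℕ) (p : ℝ[X]) (n : ℕ) : ℝ :=
  (-(d : ℝ)) ^ (n - 1) / ((n - 1).factorial : ℝ) *
    ∑ π : SetPartition n,
      (-1) ^ (π.parts.card - 1) * ((π.parts.card - 1).factorial : ℝ) * prodOver (normCoeff d p) π

/-- The `n`-th moment `(1/d) ∑ λⁿ` of the root distribution of a polynomial of degree `d`, the sum
being over the `d` complex roots with multiplicity (`p ⊠_d q` need not be real-rooted). This sum is
real, see `rootPowerSum_im`; for a real-rooted polynomial see `rootMoment_of_splits`. -/
noncomputable def rootMoment (d : ℕ) (p : ℝ[X]) (n : ℕ) : ℝ :=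
  ((p.aroots ℂ).map (fun z => z ^ n)).sum.re / (d : ℝ)

theorem rootMoment_of_splits (d : ℕ) {p : ℝ[X]} (hp : p.Splits) (n : ℕ) :
    rootMoment d p n = (p.roots.map (fun x => x ^ n)).sum / (d : ℝ) := by
  have h : p.aroots ℂ = p.roots.map (algebraMap ℝ ℂ) := hp.roots_map (algebraMap ℝ ℂ)
  have h2 : ((p.aroots ℂ).map (fun z => z ^ n)).sum
      = (((p.roots.map (fun x => x ^ n)).sum : ℝ) : ℂ) := by
    rw [h, Multiset.map_map]
    have := map_multiset_sum (algebraMap ℝ ℂ) (p.roots.map (fun x => x ^ n))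
    rw [Multiset.map_map] at this
    simpa [Function.comp_def] using this.symm
  rw [rootMoment, h2, Complex.ofReal_re]

theorem rootPowerSum_im (p : ℝ[X]) (n : ℕ) :
    ((p.aroots ℂ).map (fun z => z ^ n)).sum.im = 0 := by
  have hc : (p.map (algebraMap ℝ ℂ)).map (starRingEnd ℂ) = p.map (algebraMap ℝ ℂ) := by
    rw [Polynomial.map_map]
    congr 1
    ext x
    simp
  have hr : (p.aroots ℂ).map (starRingEnd ℂ) = p.aroots ℂ := by
    have h := (IsAlgClosed.splits (p.map (algebraMap ℝ ℂ))).roots_map (starRingEnd ℂ)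
    rw [hc] at h
    exact h.symm
  rw [← Complex.conj_eq_iff_im, map_multiset_sum, Multiset.map_map]
  conv_rhs => rw [← hr, Multiset.map_map]
  simp

/-- `(p_d)` has infinitesimal distribution `(μ, μ')`: `μ` is a probability measure with finite
moments, `μ'` a linear functional on `ℝ[x]`, and for all `n ≥ 0`, as `d → ∞`,
`m_n(p_d) → m_n(μ)` and `d (m_n(p_d) - m_n(μ)) → μ'(xⁿ)`. (For `n = 0` this gives `μ'(1) = 0`.) -/
structure HasInfinitesimalDistribution (p : ℕ → ℝ[X]) (μ : Measure ℝ) (μ' : ℝ[X] →ₗ[ℝ] ℝ) :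
    Prop where
  isProb : IsProbWithMoments μ
  limit : ∀ n, Tendsto (fun d => rootMoment d (p d) n) atTop (𝓝 (moments μ n))
  infinitesimal : ∀ n,
    Tendsto (fun d : ℕ => (d : ℝ) * (rootMoment d (p d) n - moments μ n)) atTop (𝓝 (μ' (X ^ n)))

/-- `(p_d)` has the numbers `rhat n` as cumulant fluctuations with respect to the distribution with
moment sequence `m`: `κ_n(p_d) = r_n + rhat_n / d + o(1/d)` as `d → ∞`, for every `n ≥ 1`. -/
def HasCumulantFluctuations (p : ℕ → ℝ[X]) (m rhat : ℕ → ℝ) : Prop :=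
  ∀ n, 1 ≤ n →
    (fun d : ℕ => finiteCumulant d (p d) n - (freeCumulant m n + rhat n / (d : ℝ)))
      =o[atTop] (fun d : ℕ => 1 / (d : ℝ))

/-- The formula for the cumulant fluctuations of the product, from the free cumulants `u`, `v` and
the cumulant fluctuations `u'`, `v'` of the factors. -/
noncomputable def mulFluctuation (u u' v v' : ℕ → ℝ) (n : ℕ) : ℝ :=
  (∑ π ∈ NC n,
    (derivOver u u' π * prodOver v (kreweras π) + prodOver u π * derivOver v v' (kreweras π)))
    - annularSum u v n

/-- The formula for the infinitesimal moments in terms of the free cumulants `u` and the cumulant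
fluctuations `u'`:
`∑_{π ∈ NC(n)} ∑_{V ∈ π} u'_{|V|} u_{π∖V} - (n/2) ∑_{t+s=n} ∑_{σ ∈ S_NC(t,s)} u_σ / (ts)`. -/
noncomputable def infinitesimalMoment (u u' : ℕ → ℝ) (n : ℕ) : ℝ :=
  (∑ π ∈ NC n, derivOver u u' π) - annularSum u (fun _ => 1) n

end FiniteFree

/-!
The exponential formula inverts the definition of the finite free cumulants `κ` of `p`: the
coefficient `ã_n(p)` is the sum of `(-1/d)^{n - #σ} κ_σ(p)` over all permutations `σ` of `[n]`,
where `#σ` is the number of cycles. The coefficient `ã_n(p) ã_n(q)` of the convolution is then a sum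
over pairs of permutations, and passing back to cumulants keeps the pairs `(σ, τ)` that generate a
transitive group, each with weight `(-1/d)^{n + 1 - #σ - #τ} / (n - 1)!`.

For such pairs `#σ + #τ + #(στ) ≤ n + 2`, with equality modulo 2. So weight exponent `0` forces `στ`
to be an `n`-cycle and `σ` to be non-crossing relative to it, which gives the free multiplicative
convolution; exponent `1` forces `στ` to have two cycles, which gives the annular non-crossing
correction; all other pairs contribute `O(1/d²)`.

The moments of `p` are, by Newton's identities, the cumulants of the product of `ã(p)` with a
Laguerre sequence all of whose cumulants are `1`. Hence the passage from cumulants to moments is a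
special case of the product formula, and the converse passage follows because that formula is
triangular in the cumulants of `p`.
-/

namespace FiniteFree

/-! ### The exponential formula -/

section ExponentialFormula

variable {R α : Type*}

/-- `∑ aₙ zⁿ/n! = exp (∑_{n ≥ 1} cₙ zⁿ/n!)`, up to the value of `a 0`: this is the recursion between
the coefficients that comes from differentiating, and it makes sense without denominators. -/
def IsExpSeq [CommSemiring R] (a c : ℕ → R) : Prop :=
  ∀ n, a (n + 1) = ∑ k ∈ Finset.range (n + 1), (n.choose k : R) * c (k + 1) * a (n - k)

theorem IsExpSeq.log_unique [CommRing R] {a c c' : ℕ → R} (h0 : a 0 = 1) (h : IsExpSeq a c)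
    (h' : IsExpSeq a c') : ∀ n, 1 ≤ n → c n = c' n := by
  intro n
  induction n using Nat.strong_induction_on with
  | _ n ih =>
    intro hn
    obtain ⟨n, rfl⟩ := Nat.exists_eq_add_of_le' hn
    have top_terms := (h n).symm.trans (h' n)
    rw [Finset.sum_range_succ, Finset.sum_range_succ, Finset.sum_congr rfl fun k hk => by
      rw [ih (k + 1) (by simpa using hk) (by lia)]] at top_terms
    simpa [h0] using top_terms

theorem IsExpSeq.exp_unique [CommSemiring R] {a a' c : ℕ → R} (h0 : a 0 = a' 0)
    (h : IsExpSeq a c) (h' : IsExpSeq a' c) : a = a' := by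
  ext n
  induction n using Nat.strong_induction_on with
  | _ n ih =>
    obtain _ | n := n
    · exact h0
    rw [h n, h' n]
    exact Finset.sum_congr rfl fun k _ => by rw [ih (n - k) (by lia)]

theorem IsExpSeq.congr_log [CommSemiring R] {a c c' : ℕ → R} (h : IsExpSeq a c)
    (hc : ∀ n, 1 ≤ n → c n = c' n) : IsExpSeq a c' := fun n => by
  rw [h n]
  exact Finset.sum_congr rfl fun k _ => by rw [hc (k + 1) (by lia)]

/-- The coefficients `c` of the logarithm of the exponential generating series of `a`, for
`a 0 = 1`. -/
def logSeq [CommRing R] (a : ℕ → R) : ℕ → R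
  | 0 => 0
  | n + 1 => a (n + 1) - ∑ k : Fin n, (n.choose k : R) * logSeq a (k + 1) * a (n - k)

theorem isExpSeq_logSeq [CommRing R] {a : ℕ → R} (h0 : a 0 = 1) : IsExpSeq a (logSeq a) := by
  intro n
  rw [Finset.sum_range_succ, logSeq, ← Fin.sum_univ_eq_sum_range
    (fun k => (n.choose k : R) * logSeq a (k + 1) * a (n - k)) n]
  simp [h0]

variable [DecidableEq α]

theorem sum_powerset_erase_choose [CommSemiring R] {S : Finset α} {x : α} {n : ℕ}
    (hx : x ∈ S) (hn : S.card = n + 1) (f : ℕ → ℕ → R) :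
    ∑ U ∈ (S.erase x).powerset, f (S \ U).card U.card =
      ∑ k ∈ Finset.range (n + 1), (n.choose k : R) * f (k + 1) (n - k) := by
  have hcard : (S.erase x).card = n := by rw [Finset.card_erase_of_mem hx]; lia
  have hcompl : ∀ U ∈ (S.erase x).powerset, f (S \ U).card U.card = f (n + 1 - U.card) U.card := by
    intro U hU
    rw [Finset.card_sdiff_of_subset ((Finset.mem_powerset.1 hU).trans (Finset.erase_subset _ _)),
      hn]
  rw [Finset.sum_congr rfl hcompl, Finset.sum_powerset_apply_card fun k => f (n + 1 - k) k, hcard,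
    ← Finset.sum_range_reflect]
  refine Finset.sum_congr rfl fun k hk => ?_
  have hkn : k ≤ n := Nat.lt_succ_iff.1 (Finset.mem_range.1 hk)
  rw [nsmul_eq_mul, Nat.add_sub_cancel, Nat.choose_symm hkn,
    show n + 1 - (n - k) = k + 1 by lia]

theorem IsExpSeq.eq_sum_powerset [CommSemiring R] {a c : ℕ → R} (h : IsExpSeq a c)
    {S : Finset α} {x : α} (hx : x ∈ S) :
    a S.card = ∑ U ∈ (S.erase x).powerset, c (S \ U).card * a U.card := by
  obtain ⟨n, hn⟩ := Nat.exists_eq_add_of_le' (Finset.card_pos.2 ⟨x, hx⟩)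
  rw [sum_powerset_erase_choose hx hn fun k l => c k * a l, hn, h n]
  simp only [mul_assoc]

/-- The sum of `h |π| ∏_{V ∈ π} a |V|` over the partitions `π` of `S`. -/
def partitionSum [CommSemiring R] (h a : ℕ → R) (S : Finset α) : R :=
  ∑ π : Finpartition S, h π.parts.card * ∏ V ∈ π.parts, a V.card

theorem notMem_parts_of_sdiff {S U : Finset α} (hU : U.Nonempty)
    (ρ : Finpartition (S \ U)) : U ∉ ρ.parts := fun hmem => by
  obtain ⟨y, hy⟩ := hU
  exact (Finset.mem_sdiff.1 (ρ.subset hmem hy)).2 hy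

theorem parts_avoid_of_mem {S U : Finset α} (π : Finpartition S) (hU : U ∈ π.parts) :
    (π.avoid U).parts = π.parts.erase U := by
  ext W
  rw [Finpartition.mem_avoid, Finset.mem_erase]
  constructor
  · rintro ⟨D, hD, hle, rfl⟩
    have hne : D ≠ U := fun e => hle e.le
    rw [show D \ U = D from sdiff_eq_left.2 (π.disjoint hD hU hne)]
    exact ⟨hne, hD⟩
  · rintro ⟨hne, hW⟩
    refine ⟨W, hW, fun hle => ?_, sdiff_eq_left.2 (π.disjoint hW hU hne)⟩
    obtain ⟨y, hy⟩ := π.nonempty_of_mem_parts hW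
    exact hne (π.eq_of_mem_parts hW hU hy (hle hy))

theorem sum_finpartition_sdiff [AddCommMonoid R] {S U : Finset α} (hU : U.Nonempty) (hUS : U ⊆ S)
    (F : Finset (Finset α) → R) :
    ∑ ρ : Finpartition (S \ U), F ρ.parts =
      ∑ π : Finpartition S with U ∈ π.parts, F (π.parts.erase U) := by
  have hnotMem := notMem_parts_of_sdiff (S := S) hU
  refine Finset.sum_bij'
    (fun ρ _ => ρ.extend hU.ne_empty Finset.sdiff_disjoint (Finset.sdiff_union_of_subset hUS))
    (fun π _ => π.avoid U) ?_ ?_ ?_ ?_ ?_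
  · intro ρ _
    simp
  · intro π _
    exact Finset.mem_univ _
  · intro ρ _
    ext1
    rw [parts_avoid_of_mem _ (by simp), Finpartition.extend_parts,
      Finset.erase_insert (hnotMem ρ)]
  · intro π hπ
    have hmem := (Finset.mem_filter.1 hπ).2
    ext1
    rw [Finpartition.extend_parts, parts_avoid_of_mem π hmem, Finset.insert_erase hmem]
  · intro ρ _
    rw [Finpartition.extend_parts, Finset.erase_insert (hnotMem ρ)]

theorem sum_partitionSum_sdiff_mul [CommSemiring R] (h a : ℕ → R) {S : Finset α} {x : α}
    (hx : x ∈ S) :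
    ∑ U ∈ (S.erase x).powerset.erase ∅, partitionSum h a (S \ U) * a U.card =
      partitionSum (fun m => ((m - 1 : ℕ) : R) * h (m - 1)) a S := by
  have by_block : ∀ U ∈ (S.erase x).powerset.erase ∅, partitionSum h a (S \ U) * a U.card =
      ∑ π : Finpartition S with U ∈ π.parts, h (π.parts.card - 1) * ∏ V ∈ π.parts, a V.card := by
    intro U hU
    obtain ⟨hne, hsub⟩ := Finset.mem_erase.1 hU
    rw [partitionSum, sum_finpartition_sdiff (Finset.nonempty_iff_ne_empty.2 hne)
      ((Finset.mem_powerset.1 hsub).trans (Finset.erase_subset _ _))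
      fun P => h P.card * ∏ V ∈ P, a V.card, Finset.sum_mul]
    refine Finset.sum_congr rfl fun π hπ => ?_
    have hmem := (Finset.mem_filter.1 hπ).2
    rw [Finset.card_erase_of_mem hmem, mul_assoc, Finset.prod_erase_mul _ _ hmem]
  have mem_iff : ∀ (U : Finset α) (π : Finpartition S),
      U ∈ (S.erase x).powerset.erase ∅ ∧ π ∈ Finset.univ.filter (U ∈ ·.parts) ↔
        U ∈ π.parts.erase (π.part x) ∧ π ∈ Finset.univ := by
    intro U π
    simp only [Finset.mem_erase, Finset.mem_powerset, Finset.mem_filter, Finset.mem_univ, true_and,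
      and_true, Finset.subset_erase]
    constructor
    · rintro ⟨⟨-, -, hxU⟩, hU⟩
      exact ⟨fun e => hxU (e ▸ π.mem_part hx), hU⟩
    · rintro ⟨hne, hU⟩
      exact ⟨⟨π.ne_empty hU, π.subset hU, fun hxU => hne (π.part_eq_of_mem hU hxU).symm⟩, hU⟩
  rw [Finset.sum_congr rfl by_block, Finset.sum_comm' mem_iff, partitionSum]
  refine Finset.sum_congr rfl fun π _ => ?_
  rw [Finset.sum_const, Finset.card_erase_of_mem (π.part_mem.2 hx), nsmul_eq_mul, mul_assoc]

theorem partitionSum_ite_eq_one [CommSemiring R] (a : ℕ → R) {S : Finset α} (hS : S.Nonempty) :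
    partitionSum (fun m => if m = 1 then 1 else 0) a S = a S.card := by
  rw [partitionSum, Finset.sum_eq_single (Finpartition.indiscrete hS.ne_empty)]
  · simp
  · intro π _ hπ
    rw [if_neg, zero_mul]
    intro hcard
    obtain ⟨V, hV⟩ := Finset.card_eq_one.1 hcard
    have hVS : V = S := by simpa [hV] using π.biUnion_parts
    exact hπ (by ext1; rw [hV, hVS, Finpartition.indiscrete_parts])
  · simp

/-- The value `(-1)^{m-1} (m-1)!` at `m ≥ 1` blocks of the Möbius function of the lattice of
partitions. -/
def moebiusWeight [Ring R] (m : ℕ) : R := (-1) ^ (m - 1) * ((m - 1).factorial : R)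

theorem moebiusWeight_add_mul_pred [CommRing R] {m : ℕ} (hm : 1 ≤ m) :
    (moebiusWeight m + ((m - 1 : ℕ) : R) * moebiusWeight (m - 1) : R) = if m = 1 then 1 else 0 := by
  obtain ⟨m, rfl⟩ := Nat.exists_eq_add_of_le' hm
  obtain _ | m := m
  · simp [moebiusWeight]
  · simp only [moebiusWeight, Nat.add_sub_cancel, pow_succ, Nat.factorial_succ, Nat.cast_mul,
      Nat.add_eq_right, Nat.succ_ne_zero, if_false]
    ring

theorem sum_partitionSum_moebiusWeight_mul [CommRing R] {a : ℕ → R} (h0 : a 0 = 1)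
    {S : Finset α} {x : α} (hx : x ∈ S) :
    ∑ U ∈ (S.erase x).powerset, partitionSum moebiusWeight a (S \ U) * a U.card = a S.card := by
  rw [← Finset.add_sum_erase _ _ (Finset.empty_mem_powerset _), sum_partitionSum_sdiff_mul _ _ hx,
    Finset.sdiff_empty, Finset.card_empty, h0, mul_one, ← partitionSum_ite_eq_one a ⟨x, hx⟩]
  simp only [partitionSum, ← Finset.sum_add_distrib, ← add_mul]
  refine Finset.sum_congr rfl fun π _ => ?_
  rw [moebiusWeight_add_mul_pred
    (Finset.card_pos.2 (π.parts_nonempty (Finset.ne_empty_of_mem hx)))]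

theorem IsExpSeq.partitionSum_moebiusWeight [CommRing R] {a c : ℕ → R} (h0 : a 0 = 1)
    (h : IsExpSeq a c) {S : Finset α} (hS : S.Nonempty) :
    partitionSum moebiusWeight a S = c S.card := by
  induction S using Finset.strongInduction with
  | H S ih =>
    obtain ⟨x, hx⟩ := hS
    have top_terms := (sum_partitionSum_moebiusWeight_mul h0 hx).trans (h.eq_sum_powerset hx)
    have lower_terms : ∀ U ∈ (S.erase x).powerset.erase ∅,
        partitionSum moebiusWeight a (S \ U) * a U.card = c (S \ U).card * a U.card := by
      intro U hU
      obtain ⟨hne, hsub⟩ := Finset.mem_erase.1 hU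
      obtain ⟨hUS, hxU⟩ := Finset.subset_erase.1 (Finset.mem_powerset.1 hsub)
      rw [ih _ (Finset.sdiff_ssubset hUS (Finset.nonempty_iff_ne_empty.2 hne))
        ⟨x, Finset.mem_sdiff.2 ⟨hx, hxU⟩⟩]
    rw [← Finset.add_sum_erase _ _ (Finset.empty_mem_powerset _),
      ← Finset.add_sum_erase _ _ (Finset.empty_mem_powerset _), Finset.sum_congr rfl lower_terms,
      add_left_inj] at top_terms
    simpa [h0] using top_terms

end ExponentialFormula

/-! ### Cycles of permutations -/

section Cycles

variable {α β : Type*} [Fintype α] [DecidableEq α] [Fintype β] [DecidableEq β]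

theorem parts_partition_extendDomain {p : β → Prop} [DecidablePred p] (f : α ≃ Subtype p)
    (σ : Equiv.Perm α) :
    (σ.extendDomain f).partition.parts =
      σ.partition.parts + Multiset.replicate (Fintype.card β - Fintype.card α) 1 := by
  have hσ := σ.sum_cycleType_le
  have hcard : Fintype.card α ≤ Fintype.card β :=
    Fintype.card_le_of_injective (fun a => (f a : β)) (Subtype.val_injective.comp f.injective)
  rw [Equiv.Perm.parts_partition, Equiv.Perm.parts_partition, ← Equiv.Perm.sum_cycleType,
    ← Equiv.Perm.sum_cycleType, Equiv.Perm.cycleType_extendDomain, add_assoc,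
    ← Multiset.replicate_add]
  congr 2
  lia

theorem parts_partition_permCongr (e : α ≃ β) (σ : Equiv.Perm α) :
    (e.permCongr σ).partition.parts = σ.partition.parts := by
  have h : e.permCongr σ = σ.extendDomain (p := fun _ : β => True)
      (e.trans (Equiv.subtypeUnivEquiv fun _ => trivial).symm) := by
    ext b
    rw [Equiv.Perm.extendDomain_apply_subtype _ _ (b := b) trivial]
    simp [Equiv.subtypeUnivEquiv]
  rw [h, parts_partition_extendDomain, Nat.sub_eq_zero_of_le (Fintype.card_congr e).ge,
    Multiset.replicate_zero, add_zero]

theorem cycleType_sumCongr (σ : Equiv.Perm α) (τ : Equiv.Perm β) :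
    (Equiv.Perm.sumCongr σ τ).cycleType = σ.cycleType + τ.cycleType := by
  set σ' := σ.extendDomain (Equiv.ofInjective (Sum.inl : α → α ⊕ β) Sum.inl_injective) with hσ'
  set τ' := τ.extendDomain (Equiv.ofInjective (Sum.inr : β → α ⊕ β) Sum.inr_injective) with hτ'
  have σ'_inl : ∀ a, σ' (Sum.inl a) = Sum.inl (σ a) := fun a =>
    Equiv.Perm.extendDomain_apply_image σ (Equiv.ofInjective _ Sum.inl_injective) a
  have σ'_inr : ∀ b, σ' (Sum.inr b) = Sum.inr b := fun b =>
    Equiv.Perm.extendDomain_apply_not_subtype σ _ (by simp)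
  have τ'_inl : ∀ a, τ' (Sum.inl a) = Sum.inl a := fun a =>
    Equiv.Perm.extendDomain_apply_not_subtype τ _ (by simp)
  have τ'_inr : ∀ b, τ' (Sum.inr b) = Sum.inr (τ b) := fun b =>
    Equiv.Perm.extendDomain_apply_image τ (Equiv.ofInjective _ Sum.inr_injective) b
  have factor : Equiv.Perm.sumCongr σ τ = σ' * τ' := by
    ext (a | b)
    · simp [τ'_inl, σ'_inl]
    · simp [τ'_inr, σ'_inr]
  have disjoint : σ'.Disjoint τ'
    | Sum.inl a => Or.inr (τ'_inl a)
    | Sum.inr b => Or.inl (σ'_inr b)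
  rw [factor, disjoint.cycleType_mul, hσ', hτ', Equiv.Perm.cycleType_extendDomain,
    Equiv.Perm.cycleType_extendDomain]

theorem parts_partition_sumCongr (σ : Equiv.Perm α) (τ : Equiv.Perm β) :
    (Equiv.Perm.sumCongr σ τ).partition.parts =
      σ.partition.parts + τ.partition.parts := by
  have hσ := σ.sum_cycleType_le
  have hτ := τ.sum_cycleType_le
  simp only [Equiv.Perm.parts_partition, ← Equiv.Perm.sum_cycleType, cycleType_sumCongr,
    Multiset.sum_add, Fintype.card_sum]
  rw [add_add_add_comm, ← Multiset.replicate_add, tsub_add_tsub_comm hσ hτ]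

variable {M : Type*} [CommMonoid M]

/-- The product of `u |c|` over the cycles `c` of `σ`, fixed points included. -/
def cycleProd (u : ℕ → M) (σ : Equiv.Perm α) : M := (σ.partition.parts.map u).prod

/-- The number of cycles of `σ`, fixed points included. -/
def numCycles (σ : Equiv.Perm α) : ℕ := σ.partition.parts.card

theorem cycleProd_permCongr (u : ℕ → M) (e : α ≃ β) (σ : Equiv.Perm α) :
    cycleProd u (e.permCongr σ) = cycleProd u σ := by
  rw [cycleProd, parts_partition_permCongr, cycleProd]

theorem numCycles_permCongr (e : α ≃ β) (σ : Equiv.Perm α) :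
    numCycles (e.permCongr σ) = numCycles σ := by
  rw [numCycles, parts_partition_permCongr, numCycles]

theorem cycleProd_subtypeCongr (u : ℕ → M) {p : α → Prop} [DecidablePred p]
    [Fintype {a // p a}] [Fintype {a // ¬p a}] (σ : Equiv.Perm {a // p a})
    (τ : Equiv.Perm {a // ¬p a}) :
    cycleProd u (Equiv.Perm.subtypeCongr σ τ) = cycleProd u σ * cycleProd u τ := by
  rw [Equiv.Perm.subtypeCongr, cycleProd_permCongr, cycleProd, parts_partition_sumCongr,
    Multiset.map_add, Multiset.prod_add, cycleProd, cycleProd]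

theorem cycleProd_one {u : ℕ → M} (h1 : u 1 = 1) : cycleProd u (1 : Equiv.Perm α) = 1 := by
  simp [cycleProd, Equiv.Perm.parts_partition, h1]

theorem card_parts_ofSetoid (r : Setoid α) [DecidableRel r.r] :
    (Finpartition.ofSetoid r).parts.card = Nat.card (Quotient r) := by
  classical
  have class_eq_iff (x y : α) :
      Finset.univ.filter (r x) = Finset.univ.filter (r y) ↔ r x y := by
    refine ⟨fun h => ?_, fun h => ?_⟩
    · simpa using (Finset.ext_iff.1 h y).2 (by simp)
    · ext z
      simpa using ⟨r.trans (r.symm h), r.trans h⟩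
  let toClass : Quotient r → Finset α :=
    Quotient.lift (fun x => Finset.univ.filter (r x)) fun x y h => (class_eq_iff x y).2 h
  have injective : Function.Injective toClass := by
    rintro ⟨x⟩ ⟨y⟩ h
    exact Quotient.sound ((class_eq_iff x y).1 h)
  have parts_eq : (Finpartition.ofSetoid r).parts = Finset.univ.image toClass := by
    rw [Finpartition.ofSetoid, Finpartition.ofSetSetoid_parts,
      ← Finset.image_univ_of_surjective Quotient.mk_surjective, Finset.image_image]
    rfl
  rw [parts_eq, Finset.card_image_of_injective _ injective, Finset.card_univ,
    Nat.card_eq_fintype_card]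

theorem parts_ofSetoid_sameCycle (σ : Equiv.Perm α)
    [DecidableRel (Equiv.Perm.SameCycle.setoid σ).r] :
    (Finpartition.ofSetoid (Equiv.Perm.SameCycle.setoid σ)).parts =
      σ.cycleFactorsFinset.image Equiv.Perm.support ∪ σ.supportᶜ.image singleton := by
  have orbit_of_moved {c : Equiv.Perm α} {x : α} (hc : c ∈ σ.cycleFactorsFinset)
      (hx : x ∈ c.support) :
      Finset.univ.filter (Equiv.Perm.SameCycle.setoid σ x) = c.support := by
    have hσx := Equiv.Perm.mem_cycleFactorsFinset_support_le hc hx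
    ext y
    rw [Equiv.Perm.cycle_is_cycleOf hx hc,
      Equiv.Perm.mem_support_cycleOf_iff' (Equiv.Perm.mem_support.1 hσx), Finset.mem_filter]
    exact and_iff_right (Finset.mem_univ y)
  have orbit_of_fixed {x : α} (hx : x ∉ σ.support) :
      Finset.univ.filter (Equiv.Perm.SameCycle.setoid σ x) = {x} := by
    ext y
    have hfix := Equiv.Perm.notMem_support.1 hx
    simp only [Finset.mem_filter, Finset.mem_univ, true_and, Finset.mem_singleton]
    refine ⟨?_, fun h => h ▸ Equiv.Perm.SameCycle.refl σ y⟩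
    rintro ⟨i, rfl⟩
    exact Equiv.Perm.zpow_apply_eq_self_of_apply_eq_self hfix i
  ext V
  rw [Finpartition.ofSetoid, Finpartition.ofSetSetoid_parts]
  simp only [Finset.mem_union, Finset.mem_image, Finset.mem_compl, Finset.mem_univ, true_and]
  constructor
  · rintro ⟨x, rfl⟩
    by_cases hx : x ∈ σ.support
    · have hc := Equiv.Perm.cycleOf_mem_cycleFactorsFinset_iff.2 hx
      exact Or.inl ⟨_, hc, (orbit_of_moved hc (Equiv.Perm.mem_support_cycleOf_iff.2
        ⟨Equiv.Perm.SameCycle.refl σ x, hx⟩)).symm⟩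
    · exact Or.inr ⟨x, hx, (orbit_of_fixed hx).symm⟩
  · rintro (⟨c, hc, rfl⟩ | ⟨x, hx, rfl⟩)
    · obtain ⟨x, hx⟩ := (Equiv.Perm.mem_cycleFactorsFinset_iff.1 hc).1.nonempty_support
      exact ⟨x, orbit_of_moved hc hx⟩
    · exact ⟨x, orbit_of_fixed hx⟩

theorem map_card_parts_ofSetoid_sameCycle (σ : Equiv.Perm α)
    [DecidableRel (Equiv.Perm.SameCycle.setoid σ).r] :
    (Finpartition.ofSetoid (Equiv.Perm.SameCycle.setoid σ)).parts.val.map Finset.card =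
      σ.partition.parts := by
  have disjoint : Disjoint (σ.cycleFactorsFinset.image Equiv.Perm.support)
      (σ.supportᶜ.image singleton) := by
    simp only [Finset.disjoint_left, Finset.mem_image, not_exists, not_and]
    rintro _ ⟨c, hc, rfl⟩ x - hx
    have := (Equiv.Perm.mem_cycleFactorsFinset_iff.1 hc).1.two_le_card_support
    simp [← hx] at this
  have support_injOn :
      Set.InjOn Equiv.Perm.support (σ.cycleFactorsFinset : Set (Equiv.Perm α)) := by
    intro c hc c' hc' h
    obtain ⟨x, hx⟩ := (Equiv.Perm.mem_cycleFactorsFinset_iff.1 hc).1.nonempty_support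
    rw [Equiv.Perm.cycle_is_cycleOf hx hc, Equiv.Perm.cycle_is_cycleOf (h ▸ hx) hc']
  rw [parts_ofSetoid_sameCycle, ← Finset.disjUnion_eq_union _ _ disjoint, Finset.disjUnion_val,
    Multiset.map_add, Equiv.Perm.parts_partition, Equiv.Perm.cycleType_def,
    Finset.image_val_of_injOn support_injOn,
    Finset.image_val_of_injOn Finset.singleton_injective.injOn, Multiset.map_map, Multiset.map_map]
  simp only [Function.comp_def, Finset.card_singleton, Multiset.map_const', ← Finset.card_def,
    Finset.card_compl]

theorem numCycles_eq_card_quotient (σ : Equiv.Perm α) :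
    numCycles σ = Nat.card (Quotient (Equiv.Perm.SameCycle.setoid σ)) := by
  classical
  rw [← card_parts_ofSetoid, numCycles, ← map_card_parts_ofSetoid_sameCycle, Multiset.card_map,
    Finset.card_def]

end Cycles

theorem cycleProd_eq_prodOver (u : ℕ → ℝ) {n : ℕ} (σ : Equiv.Perm (Fin n)) :
    cycleProd u σ = prodOver u (cyclePartition σ) := by
  classical
  rw [cycleProd, ← map_card_parts_ofSetoid_sameCycle, Multiset.map_map, prodOver, cyclePartition,
    Finset.prod]
  rfl

theorem numCycles_eq_card_cyclePartition {n : ℕ} (σ : Equiv.Perm (Fin n)) :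
    numCycles σ = (cyclePartition σ).parts.card := by
  classical
  rw [numCycles, ← map_card_parts_ofSetoid_sameCycle, Multiset.card_map, cyclePartition,
    Finset.card_def]

/-! ### Joint orbits of pairs of permutations -/

theorem setoid_sameCycle_le_iff {α : Type*} {σ : Equiv.Perm α} {r : Setoid α} :
    Equiv.Perm.SameCycle.setoid σ ≤ r ↔ ∀ x, r x (σ x) := by
  refine ⟨fun h x => h ⟨1, by simp⟩, fun h => ?_⟩
  have pow_rel (n : ℕ) (x : α) : r x ((σ ^ n) x) := by
    induction n with
    | zero => exact r.refl x
    | succ n ih => exact pow_succ' σ n ▸ r.trans ih (h _)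
  rintro x y ⟨i, rfl⟩
  obtain ⟨n, rfl | rfl⟩ := i.eq_nat_or_neg
  · simpa using pow_rel n x
  · simpa using r.symm (pow_rel n ((σ ^ (-(n : ℤ))) x))

theorem setoid_sameCycle_one {α : Type*} :
    Equiv.Perm.SameCycle.setoid (1 : Equiv.Perm α) = ⊥ :=
  eq_bot_iff.2 (setoid_sameCycle_le_iff.2 fun _ => rfl)

/-- The orbit relation of the group generated by two permutations. -/
def jointOrbits {α : Type*} (σ τ : Equiv.Perm α) : Setoid α :=
  Equiv.Perm.SameCycle.setoid σ ⊔ Equiv.Perm.SameCycle.setoid τ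

theorem jointOrbits_le_iff {α : Type*} {σ τ : Equiv.Perm α} {r : Setoid α} :
    jointOrbits σ τ ≤ r ↔ (∀ x, r x (σ x)) ∧ ∀ x, r x (τ x) := by
  rw [jointOrbits, sup_le_iff, setoid_sameCycle_le_iff, setoid_sameCycle_le_iff]

theorem jointOrbits_left {α : Type*} (σ τ : Equiv.Perm α) (x : α) : jointOrbits σ τ x (σ x) :=
  (jointOrbits_le_iff.1 le_rfl).1 x

theorem jointOrbits_right {α : Type*} (σ τ : Equiv.Perm α) (x : α) : jointOrbits σ τ x (τ x) :=
  (jointOrbits_le_iff.1 le_rfl).2 x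

theorem jointOrbits_le_comap_permCongr {α β : Type*} (e : α ≃ β) (σ τ : Equiv.Perm α) :
    jointOrbits σ τ ≤ (jointOrbits (e.permCongr σ) (e.permCongr τ)).comap e :=
  jointOrbits_le_iff.2
    ⟨fun x => by
      simpa [Setoid.comap_rel] using jointOrbits_left (e.permCongr σ) (e.permCongr τ) (e x),
    fun x => by
      simpa [Setoid.comap_rel] using jointOrbits_right (e.permCongr σ) (e.permCongr τ) (e x)⟩

theorem jointOrbits_permCongr_eq_top {α β : Type*} (e : α ≃ β) {σ τ : Equiv.Perm α}
    (h : jointOrbits σ τ = ⊤) : jointOrbits (e.permCongr σ) (e.permCongr τ) = ⊤ := by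
  have le_comap := jointOrbits_le_comap_permCongr e σ τ
  rw [h] at le_comap
  rw [eq_top_iff]
  intro x y _
  simpa [Setoid.comap_rel] using le_comap (x := e.symm x) (y := e.symm y) trivial

theorem jointOrbits_permCongr_eq_top_iff {α β : Type*} (e : α ≃ β) {σ τ : Equiv.Perm α} :
    jointOrbits (e.permCongr σ) (e.permCongr τ) = ⊤ ↔ jointOrbits σ τ = ⊤ :=
  ⟨fun h => by
    simpa only [← Equiv.permCongr_symm, Equiv.symm_apply_apply] using
      jointOrbits_permCongr_eq_top e.symm h,
    jointOrbits_permCongr_eq_top e⟩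

section Gluing

variable {α : Type*} {p : α → Prop} [DecidablePred p]

theorem jointOrbits_subtypeCongr (σ τ : Equiv.Perm {a // p a}) (σ' τ' : Equiv.Perm {a // ¬p a})
    (x : {a // ¬p a}) (y : α) :
    jointOrbits (σ.subtypeCongr σ') (τ.subtypeCongr τ') x y ↔
      ∃ hy : ¬p y, jointOrbits σ' τ' x ⟨y, hy⟩ := by
  constructor
  · let r : Setoid α :=
      { r := fun a b => (p a ↔ p b) ∧ ∀ ha hb, jointOrbits σ' τ' ⟨a, ha⟩ ⟨b, hb⟩
        iseqv :=
          ⟨fun a => ⟨Iff.rfl, fun _ _ => (jointOrbits σ' τ').refl _⟩,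
            fun h => ⟨h.1.symm, fun ha hb => (jointOrbits σ' τ').symm (h.2 hb ha)⟩,
            fun h h' => ⟨h.1.trans h'.1, fun ha hb => (jointOrbits σ' τ').trans
              (h.2 ha (mt h.1.2 ha)) (h'.2 (mt h.1.2 ha) hb)⟩⟩ }
    have rel_glue (ρ : Equiv.Perm {a // p a}) (ρ' : Equiv.Perm {a // ¬p a})
        (hρ' : ∀ a, jointOrbits σ' τ' a (ρ' a)) (a : α) : r a (ρ.subtypeCongr ρ' a) := by
      by_cases ha : p a
      · rw [Equiv.Perm.subtypeCongr.left_apply _ _ ha]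
        exact ⟨iff_of_true ha (ρ ⟨a, ha⟩).2, fun hna => absurd ha hna⟩
      · rw [Equiv.Perm.subtypeCongr.right_apply _ _ ha]
        exact ⟨iff_of_false ha (ρ' ⟨a, ha⟩).2, fun _ _ => hρ' ⟨a, ha⟩⟩
    have le_r : jointOrbits (σ.subtypeCongr σ') (τ.subtypeCongr τ') ≤ r :=
      jointOrbits_le_iff.2
        ⟨rel_glue σ σ' (jointOrbits_left σ' τ'), rel_glue τ τ' (jointOrbits_right σ' τ')⟩
    intro h
    have hy : ¬p y := mt (le_r h).1.2 x.2
    exact ⟨hy, (le_r h).2 x.2 hy⟩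
  · rintro ⟨hy, h⟩
    have le_comap : jointOrbits σ' τ' ≤
        (jointOrbits (σ.subtypeCongr σ') (τ.subtypeCongr τ')).comap Subtype.val :=
      jointOrbits_le_iff.2
        ⟨fun a => by
          simpa [Setoid.comap_rel] using
            jointOrbits_left (σ.subtypeCongr σ') (τ.subtypeCongr τ') (a : α),
        fun a => by
          simpa [Setoid.comap_rel] using
            jointOrbits_right (σ.subtypeCongr σ') (τ.subtypeCongr τ') (a : α)⟩
    exact le_comap h

theorem jointOrbits_eq_top_iff_subtypeCongr (σ τ : Equiv.Perm {a // p a})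
    (σ' τ' : Equiv.Perm {a // ¬p a}) {x : α} (hx : ¬p x) :
    jointOrbits σ' τ' = ⊤ ↔
      ∀ y, jointOrbits (σ.subtypeCongr σ') (τ.subtypeCongr τ') x y ↔ ¬p y := by
  simp only [jointOrbits_subtypeCongr σ τ σ' τ' ⟨x, hx⟩]
  constructor
  · rintro h y
    exact ⟨fun hy => hy.1, fun hy => ⟨hy, h ▸ trivial⟩⟩
  · intro h
    have rel_x (y : {a // ¬p a}) : jointOrbits σ' τ' ⟨x, hx⟩ y := ((h y).2 y.2).2
    exact eq_top_iff.2 fun a b _ =>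
      (jointOrbits σ' τ').trans ((jointOrbits σ' τ').symm (rel_x a)) (rel_x b)

theorem exists_subtypeCongr_eq {σ : Equiv.Perm α} (h : ∀ a, p (σ a) ↔ p a) :
    ∃ (σ₁ : Equiv.Perm {a // p a}) (σ₂ : Equiv.Perm {a // ¬p a}), σ₁.subtypeCongr σ₂ = σ := by
  refine ⟨σ.subtypePerm h, σ.subtypePerm fun a => not_congr (h a), Equiv.ext fun a => ?_⟩
  by_cases ha : p a
  · rw [Equiv.Perm.subtypeCongr.left_apply _ _ ha]
    rfl
  · rw [Equiv.Perm.subtypeCongr.right_apply _ _ ha]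
    rfl

end Gluing

section TransitivePairs

variable (α : Type*) {β R : Type*} [Fintype α] [DecidableEq α] [Fintype β] [DecidableEq β]

open Classical in
/-- The pairs of permutations generating a transitive group. -/
noncomputable def transitivePairs : Finset (Equiv.Perm α × Equiv.Perm α) :=
  Finset.univ.filter fun q => jointOrbits q.1 q.2 = ⊤

variable {α} in
theorem mem_transitivePairs {q : Equiv.Perm α × Equiv.Perm α} :
    q ∈ transitivePairs α ↔ jointOrbits q.1 q.2 = ⊤ := by
  simp [transitivePairs]

section Semiring

variable [CommSemiring R]

/-- The sum of `u_σ` over all permutations `σ` of `α`. -/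
def permSum (u : ℕ → R) : R := ∑ σ : Equiv.Perm α, cycleProd u σ

/-- The sum of `u_σ v_τ` over all pairs `(σ, τ)` of permutations generating a transitive group. -/
noncomputable def transitiveSum (u v : ℕ → R) : R :=
  ∑ q ∈ transitivePairs α, cycleProd u q.1 * cycleProd v q.2

variable {α}

theorem permSum_of_isEmpty [IsEmpty α] (u : ℕ → R) : permSum α u = 1 := by
  simp [permSum, cycleProd, Equiv.Perm.parts_partition]

theorem permSum_congr (e : α ≃ β) (u : ℕ → R) : permSum α u = permSum β u :=
  Fintype.sum_equiv e.permCongr _ _ fun σ => (cycleProd_permCongr u e σ).symm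

theorem transitiveSum_congr (e : α ≃ β) (u v : ℕ → R) :
    transitiveSum α u v = transitiveSum β u v :=
  Finset.sum_equiv (e.permCongr.prodCongr e.permCongr)
    (fun q => by simp [mem_transitivePairs, jointOrbits_permCongr_eq_top_iff])
    fun q _ => by simp [cycleProd_permCongr]

open Classical in
theorem sum_pairs_fixed_orbit (u v : ℕ → R) {x : α} {U : Finset α} (hx : x ∉ U) :
    ∑ q : Equiv.Perm α × Equiv.Perm α
        with (Finset.univ.filter fun y => ¬jointOrbits q.1 q.2 x y) = U,
      cycleProd u q.1 * cycleProd v q.2 =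
    transitiveSum {a // a ∉ U} u v * (permSum {a // a ∈ U} u * permSum {a // a ∈ U} v) := by
  rw [transitiveSum, permSum, permSum, Finset.sum_mul_sum, ← Finset.sum_product',
    Finset.sum_mul_sum, ← Finset.sum_product']
  symm
  have orbit_eq_iff (σ τ : Equiv.Perm α) :
      (Finset.univ.filter fun y => ¬jointOrbits σ τ x y) = U ↔
        ∀ y, jointOrbits σ τ x y ↔ y ∉ U := by
    simp only [Finset.ext_iff, Finset.mem_filter, Finset.mem_univ, true_and]
    exact forall_congr' fun y => not_iff_comm.trans Iff.comm
  refine Finset.sum_bij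
    (fun z _ => (z.2.1.subtypeCongr z.1.1, z.2.2.subtypeCongr z.1.2)) ?_ ?_ ?_ ?_
  · rintro ⟨⟨σ', τ'⟩, σ, τ⟩ hz
    simp only [Finset.mem_product, mem_transitivePairs, Finset.mem_univ, and_true] at hz
    simpa [orbit_eq_iff] using (jointOrbits_eq_top_iff_subtypeCongr σ τ σ' τ' hx).1 hz
  · rintro ⟨⟨σ', τ'⟩, σ, τ⟩ - ⟨⟨σ₁', τ₁'⟩, σ₁, τ₁⟩ - h
    have glue_injective := Equiv.Perm.subtypeCongrHom_injective (· ∈ U)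
    have hσ := @glue_injective (σ, σ') (σ₁, σ₁') (Prod.mk.inj h).1
    have hτ := @glue_injective (τ, τ') (τ₁, τ₁') (Prod.mk.inj h).2
    simp_all
  · rintro ⟨σ, τ⟩ hq
    have orbit := (orbit_eq_iff σ τ).1 (Finset.mem_filter.1 hq).2
    have mem_iff {a b : α} (h : jointOrbits σ τ a b) : b ∈ U ↔ a ∈ U := by
      rw [← not_iff_not, ← orbit, ← orbit]
      exact ⟨fun h' => (jointOrbits σ τ).trans h' ((jointOrbits σ τ).symm h),
        fun h' => (jointOrbits σ τ).trans h' h⟩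
    obtain ⟨σ, σ', rfl⟩ := exists_subtypeCongr_eq fun a => mem_iff (jointOrbits_left σ τ a)
    obtain ⟨τ, τ', rfl⟩ := exists_subtypeCongr_eq fun a => mem_iff (jointOrbits_right _ τ a)
    refine ⟨((σ', τ'), (σ, τ)), ?_, rfl⟩
    simpa [mem_transitivePairs] using (jointOrbits_eq_top_iff_subtypeCongr σ τ σ' τ' hx).2 orbit
  · rintro ⟨⟨σ', τ'⟩, σ, τ⟩ -
    simp only [cycleProd_subtypeCongr]
    ring

theorem permSum_mul_permSum_eq_sum_orbit (u v : ℕ → R) (x : α) :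
    permSum α u * permSum α v = ∑ U ∈ (Finset.univ.erase x).powerset,
      transitiveSum {a // a ∉ U} u v * (permSum {a // a ∈ U} u * permSum {a // a ∈ U} v) := by
  classical
  rw [permSum, permSum, Finset.sum_mul_sum, ← Finset.sum_product', Finset.univ_product_univ,
    ← Finset.sum_fiberwise_of_maps_to
      (g := fun q => Finset.univ.filter fun y => ¬jointOrbits q.1 q.2 x y)
      (t := (Finset.univ.erase x).powerset)]
  · refine Finset.sum_congr rfl fun U hU => sum_pairs_fixed_orbit u v fun hx => ?_
    exact Finset.notMem_erase x _ (Finset.mem_powerset.1 hU hx)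
  · intro q _
    simp only [Finset.mem_powerset, Finset.subset_iff, Finset.mem_filter, Finset.mem_erase,
      Finset.mem_univ, true_and, and_true]
    rintro y hy rfl
    exact hy ((jointOrbits q.1 q.2).refl y)

theorem isExpSeq_permSum_mul_permSum (u v : ℕ → R) :
    IsExpSeq (fun n => permSum (Fin n) u * permSum (Fin n) v)
      (fun n => transitiveSum (Fin n) u v) := by
  intro n
  simp only [mul_assoc]
  rw [← sum_powerset_erase_choose (Finset.mem_univ (0 : Fin (n + 1))) (by simp)
    fun k l => transitiveSum (Fin k) u v * (permSum (Fin l) u * permSum (Fin l) v),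
    permSum_mul_permSum_eq_sum_orbit u v (0 : Fin (n + 1))]
  refine Finset.sum_congr rfl fun U _ => ?_
  have eU : {a // a ∈ U} ≃ Fin U.card := Fintype.equivFinOfCardEq (Fintype.card_coe U)
  have eUc : {a // a ∉ U} ≃ Fin (Finset.univ \ U).card := Fintype.equivFinOfCardEq (by
    rw [Fintype.card_subtype_compl, Fintype.card_coe, Finset.card_univ_sdiff])
  rw [permSum_congr eU, permSum_congr eU, transitiveSum_congr eUc]

end Semiring

variable {α}

theorem parts_partition_of_setoid_eq_top [Nonempty α] {σ : Equiv.Perm α}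
    (h : Equiv.Perm.SameCycle.setoid σ = ⊤) : σ.partition.parts = {Fintype.card α} := by
  classical
  have parts_eq : (Finpartition.ofSetoid (Equiv.Perm.SameCycle.setoid σ)).parts =
      {Finset.univ} := by
    have rel (x y : α) : Equiv.Perm.SameCycle.setoid σ x y := h ▸ trivial
    ext V
    simp [Finpartition.ofSetoid, Finpartition.ofSetSetoid_parts, rel, eq_comm]
  rw [← map_card_parts_ofSetoid_sameCycle, parts_eq]
  simp

theorem cycleProd_ite_eq_one [CommSemiring R] (σ : Equiv.Perm α) :
    cycleProd (fun k => if k = 1 then (1 : R) else 0) σ = if σ = 1 then 1 else 0 := by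
  split_ifs with hσ
  · rw [hσ, cycleProd_one (by simp)]
  · obtain ⟨k, hk⟩ := Multiset.card_pos_iff_exists_mem.1 (Equiv.Perm.card_cycleType_pos.2 hσ)
    refine Multiset.prod_eq_zero (Multiset.mem_map.2 ⟨k, ?_, if_neg ?_⟩)
    · exact Equiv.Perm.parts_partition (σ := σ) ▸ Multiset.mem_add.2 (Or.inl hk)
    · have := Equiv.Perm.two_le_of_mem_cycleType hk
      lia

theorem permSum_ite_eq_one [CommSemiring R] :
    permSum α (fun k => if k = 1 then (1 : R) else 0) = 1 := by
  simp [permSum, cycleProd_ite_eq_one]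

open Classical in
theorem transitiveSum_ite_eq_one [CommSemiring R] [Nonempty α] (u : ℕ → R) :
    transitiveSum α u (fun k => if k = 1 then 1 else 0) = u (Fintype.card α) *
      ({σ : Equiv.Perm α | Equiv.Perm.SameCycle.setoid σ = ⊤} : Finset (Equiv.Perm α)).card := by
  rw [transitiveSum, mul_comm, ← nsmul_eq_mul, ← Finset.sum_const]
  symm
  refine Finset.sum_of_injOn (fun σ => (σ, 1)) (fun σ _ σ' _ h => (Prod.mk.inj h).1) ?_ ?_ ?_
  · intro σ hσ
    simpa [mem_transitivePairs, jointOrbits, setoid_sameCycle_one] using hσ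
  · rintro ⟨σ, τ⟩ hq hn
    rw [cycleProd_ite_eq_one, if_neg, mul_zero]
    rintro rfl
    refine hn ⟨σ, ?_, rfl⟩
    simpa [mem_transitivePairs, jointOrbits, setoid_sameCycle_one] using hq
  · intro σ hσ
    rw [cycleProd_ite_eq_one, if_pos rfl, mul_one, cycleProd,
      parts_partition_of_setoid_eq_top (Finset.mem_filter.1 hσ).2]
    simp

open Classical in
theorem isExpSeq_permSum_card [CommSemiring R] (u : ℕ → R) :
    IsExpSeq (fun n => permSum (Fin n) u) fun n => u n *
      ({σ : Equiv.Perm (Fin n) | Equiv.Perm.SameCycle.setoid σ = ⊤} :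
        Finset (Equiv.Perm (Fin n))).card := by
  have h := isExpSeq_permSum_mul_permSum u fun k => if k = 1 then 1 else 0
  simp only [permSum_ite_eq_one, mul_one] at h
  refine h.congr_log fun n hn => ?_
  have : Nonempty (Fin n) := ⟨⟨0, hn⟩⟩
  rw [transitiveSum_ite_eq_one, Fintype.card_fin]

open Classical in
theorem card_setoid_sameCycle_eq_top {n : ℕ} (hn : 1 ≤ n) :
    ({σ : Equiv.Perm (Fin n) | Equiv.Perm.SameCycle.setoid σ = ⊤} :
      Finset (Equiv.Perm (Fin n))).card = (n - 1).factorial := by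
  have by_orbits := isExpSeq_permSum_card (R := ℤ) fun _ => 1
  have permSum_one (n : ℕ) : permSum (Fin n) (fun _ => (1 : ℤ)) = n.factorial := by
    simp [permSum, cycleProd, Fintype.card_perm]
  have by_factorials : IsExpSeq (fun n => permSum (Fin n) fun _ => (1 : ℤ))
      (fun n => ((n - 1).factorial : ℤ)) := by
    intro m
    simp only [permSum_one, Nat.add_sub_cancel]
    rw [Finset.sum_congr rfl (g := fun _ => (m.factorial : ℤ))]
    · simp [Nat.factorial_succ]
    · intro k hk
      exact_mod_cast Nat.choose_mul_factorial_mul_factorial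
        (Nat.lt_succ_iff.1 (Finset.mem_range.1 hk))
  exact_mod_cast (one_mul _).symm.trans
    (by_orbits.log_unique (permSum_of_isEmpty _) by_factorials n hn)

theorem isExpSeq_permSum [CommSemiring R] (u : ℕ → R) :
    IsExpSeq (fun n => permSum (Fin n) u) (fun n => u n * (n - 1).factorial) := by
  classical
  exact (isExpSeq_permSum_card u).congr_log fun n hn => by rw [card_setoid_sameCycle_eq_top hn]

end TransitivePairs

/-! ### The genus inequality -/

theorem setoid_sameCycle_inv {α : Type*} (σ : Equiv.Perm α) :
    Equiv.Perm.SameCycle.setoid σ⁻¹ = Equiv.Perm.SameCycle.setoid σ :=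
  Setoid.ext fun _ _ => Equiv.Perm.sameCycle_inv

theorem setoid_sameCycle_mul_le {α : Type*} (σ τ : Equiv.Perm α) :
    Equiv.Perm.SameCycle.setoid (σ * τ) ≤ jointOrbits σ τ :=
  setoid_sameCycle_le_iff.2 fun x =>
    (jointOrbits σ τ).trans (jointOrbits_right σ τ x) (jointOrbits_left σ τ (τ x))

theorem jointOrbits_mul_right {α : Type*} (σ τ : Equiv.Perm α) :
    jointOrbits σ (σ * τ) = jointOrbits σ τ := by
  refine le_antisymm (sup_le le_sup_left (setoid_sameCycle_mul_le σ τ)) (sup_le le_sup_left ?_)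
  simpa [jointOrbits, setoid_sameCycle_inv] using setoid_sameCycle_mul_le σ⁻¹ (σ * τ)

theorem jointOrbits_mul_left {α : Type*} (σ τ : Equiv.Perm α) :
    jointOrbits (σ * τ) τ = jointOrbits σ τ := by
  refine le_antisymm (sup_le (setoid_sameCycle_mul_le σ τ) le_sup_right) (sup_le ?_ le_sup_right)
  simpa [jointOrbits, setoid_sameCycle_inv] using setoid_sameCycle_mul_le (σ * τ) τ⁻¹

theorem setoid_sameCycle_swap_le_iff {α : Type*} [DecidableEq α] {a b : α} {r : Setoid α} :
    Equiv.Perm.SameCycle.setoid (Equiv.swap a b) ≤ r ↔ r a b := by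
  rw [setoid_sameCycle_le_iff]
  refine ⟨fun h => by simpa using h a, fun h x => ?_⟩
  rcases eq_or_ne x a with rfl | hxa
  · simpa using h
  rcases eq_or_ne x b with rfl | hxb
  · simpa using r.symm h
  · rw [Equiv.swap_apply_of_ne_of_ne hxa hxb]

/-- The map identifying the class of `b` with the class of `a` in the quotient by `r`. -/
noncomputable def mergeClasses {α : Type*} (r : Setoid α) (a b : α) (x : α) : Quotient r :=
  open Classical in if r b x then Quotient.mk r a else Quotient.mk r x

theorem ker_mergeClasses {α : Type*} [DecidableEq α] (r : Setoid α) (a b : α) :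
    Setoid.ker (mergeClasses r a b) = r ⊔ Equiv.Perm.SameCycle.setoid (Equiv.swap a b) := by
  set s := r ⊔ Equiv.Perm.SameCycle.setoid (Equiv.swap a b)
  apply le_antisymm
  · intro x y hxy
    have of_r {u v : α} (h : r u v) : s u v := (le_sup_left : r ≤ s) h
    have hab : s a b := setoid_sameCycle_swap_le_iff.1 le_sup_right
    simp only [Setoid.ker_def, mergeClasses] at hxy
    split_ifs at hxy with hx hy hy
    · exact of_r (r.trans (r.symm hx) hy)
    · exact s.trans (of_r (r.symm hx)) (s.trans (s.symm hab) (of_r (Quotient.exact hxy)))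
    · exact s.trans (of_r (Quotient.exact hxy)) (s.trans hab (of_r hy))
    · exact of_r (Quotient.exact hxy)
  · rw [sup_le_iff, setoid_sameCycle_swap_le_iff]
    refine ⟨fun x y hxy => ?_, by simp [Setoid.ker_def, mergeClasses]⟩
    have rel_iff : r b x ↔ r b y := ⟨fun h => r.trans h hxy, fun h => r.trans h (r.symm hxy)⟩
    simp only [Setoid.ker_def, mergeClasses, Quotient.sound hxy]
    exact open Classical in if_congr rel_iff rfl rfl

theorem range_mergeClasses {α : Type*} {r : Setoid α} {a b : α} (h : ¬r a b) :
    Set.range (mergeClasses r a b) = {Quotient.mk r b}ᶜ := by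
  ext q
  simp only [Set.mem_range, Set.mem_compl_iff, Set.mem_singleton_iff]
  constructor
  · rintro ⟨x, rfl⟩
    rw [mergeClasses]
    split_ifs with hx
    · exact fun e => h (Quotient.exact e)
    · exact fun e => hx (r.symm (Quotient.exact e))
  · induction q using Quotient.inductionOn with
    | h x => exact fun hx => ⟨x, if_neg fun hbx => hx (Quotient.sound (r.symm hbx))⟩

theorem card_quotient_sup_swap {α : Type*} [Finite α] [DecidableEq α] {r : Setoid α} {a b : α}
    (h : ¬r a b) :
    Nat.card (Quotient (r ⊔ Equiv.Perm.SameCycle.setoid (Equiv.swap a b))) + 1 =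
      Nat.card (Quotient r) := by
  rw [← ker_mergeClasses, Nat.card_congr (Setoid.quotientKerEquivRange _), range_mergeClasses h,
    Nat.card_coe_set_eq, ← Set.ncard_singleton (Quotient.mk r b), add_comm,
    Set.ncard_add_ncard_compl]

theorem card_quotient_top {α : Type*} [Nonempty α] : Nat.card (Quotient (⊤ : Setoid α)) = 1 := by
  rw [Nat.card_eq_one_iff_unique]
  refine ⟨⟨?_⟩, ⟨Quotient.mk _ (Classical.arbitrary α)⟩⟩
  rintro ⟨x⟩ ⟨y⟩
  exact Quotient.sound trivial

section Genus

variable {α : Type*} [Fintype α] [DecidableEq α]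

theorem numCycles_eq_one_iff [Nonempty α] {σ : Equiv.Perm α} :
    numCycles σ = 1 ↔ Equiv.Perm.SameCycle.setoid σ = ⊤ := by
  rw [numCycles_eq_card_quotient]
  refine ⟨fun h => ?_, fun h => h ▸ card_quotient_top⟩
  have := (Nat.card_eq_one_iff_unique.1 h).1
  exact Setoid.eq_top_iff.2 fun x y => Quotient.exact (Subsingleton.elim _ _)

theorem numCycles_le (σ : Equiv.Perm α) : numCycles σ ≤ Fintype.card α := by
  rw [numCycles_eq_card_quotient, ← Nat.card_eq_fintype_card]
  exact Nat.card_le_card_of_surjective _ Quotient.mk_surjective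

theorem numCycles_pos [Nonempty α] (σ : Equiv.Perm α) : 0 < numCycles σ := by
  rw [numCycles_eq_card_quotient]
  have : Nonempty (Quotient (Equiv.Perm.SameCycle.setoid σ)) :=
    Nonempty.map (Quotient.mk _) inferInstance
  exact Nat.card_pos

theorem numCycles_one : numCycles (1 : Equiv.Perm α) = Fintype.card α := by
  simp [numCycles, Equiv.Perm.parts_partition]

theorem sign_eq_neg_one_pow_numCycles (σ : Equiv.Perm α) :
    Equiv.Perm.sign σ = (-1) ^ (Fintype.card α + numCycles σ) := by
  obtain ⟨k, hk⟩ := Nat.exists_eq_add_of_le σ.sum_cycleType_le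
  rw [Equiv.Perm.sign_of_cycleType, numCycles, Equiv.Perm.parts_partition, Multiset.card_add,
    Multiset.card_replicate, ← Equiv.Perm.sum_cycleType, hk, Nat.add_sub_cancel_left,
    add_add_add_comm, pow_add _ _ (k + k), Even.neg_one_pow ⟨k, rfl⟩, mul_one]

theorem even_card_add_numCycles (σ τ : Equiv.Perm α) :
    Even (Fintype.card α + (numCycles σ + numCycles τ + numCycles (σ * τ))) := by
  have h := Equiv.Perm.sign_mul σ τ
  rw [← mul_inv_eq_one, Int.units_inv_eq_self] at h
  simp only [sign_eq_neg_one_pow_numCycles, ← pow_add] at h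
  rw [neg_one_pow_eq_one_iff_even (by decide)] at h
  grind

theorem numCycles_mul_swap_ne (σ : Equiv.Perm α) {a b : α} (hab : a ≠ b) :
    numCycles (σ * Equiv.swap a b) ≠ numCycles σ := by
  intro h
  have hsign := Equiv.Perm.sign_mul σ (Equiv.swap a b)
  rw [sign_eq_neg_one_pow_numCycles, h, ← sign_eq_neg_one_pow_numCycles,
    Equiv.Perm.sign_swap hab, left_eq_mul] at hsign
  exact absurd hsign (by decide)

theorem card_quotient_jointOrbits_swap {σ : Equiv.Perm α} {a b : α} (h : σ.SameCycle a b) :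
    Nat.card (Quotient (jointOrbits σ (Equiv.swap a b))) = numCycles σ := by
  rw [jointOrbits, sup_eq_left.2 (setoid_sameCycle_swap_le_iff.2 h), numCycles_eq_card_quotient]

theorem card_quotient_jointOrbits_swap_add_one {σ : Equiv.Perm α} {a b : α}
    (h : ¬σ.SameCycle a b) :
    Nat.card (Quotient (jointOrbits σ (Equiv.swap a b))) + 1 = numCycles σ := by
  rw [jointOrbits, card_quotient_sup_swap h, numCycles_eq_card_quotient]

theorem numCycles_mul_swap_of_sameCycle {σ : Equiv.Perm α} {a b : α} (hab : a ≠ b)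
    (h : σ.SameCycle a b) : numCycles (σ * Equiv.swap a b) = numCycles σ + 1 := by
  by_cases h' : (σ * Equiv.swap a b).SameCycle a b
  · refine absurd ?_ (numCycles_mul_swap_ne σ hab)
    rw [← card_quotient_jointOrbits_swap h, ← jointOrbits_mul_left,
      card_quotient_jointOrbits_swap h']
  · rw [← card_quotient_jointOrbits_swap h, ← jointOrbits_mul_left,
      card_quotient_jointOrbits_swap_add_one h']

theorem numCycles_mul_swap_of_not_sameCycle {σ : Equiv.Perm α} {a b : α}
    (h : ¬σ.SameCycle a b) : numCycles (σ * Equiv.swap a b) + 1 = numCycles σ := by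
  by_cases h' : (σ * Equiv.swap a b).SameCycle a b
  · rw [← card_quotient_jointOrbits_swap h', jointOrbits_mul_left,
      card_quotient_jointOrbits_swap_add_one h]
  · have hab : a ≠ b := by rintro rfl; exact h (.refl σ a)
    refine absurd ?_ (numCycles_mul_swap_ne σ hab)
    rw [← card_quotient_jointOrbits_swap_add_one h', jointOrbits_mul_left,
      card_quotient_jointOrbits_swap_add_one h]

theorem numCycles_mul_swap_le (σ : Equiv.Perm α) {a b : α} (hab : a ≠ b) :
    numCycles (σ * Equiv.swap a b) ≤ numCycles σ + 1 := by
  by_cases h : σ.SameCycle a b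
  · exact (numCycles_mul_swap_of_sameCycle hab h).le
  · have := numCycles_mul_swap_of_not_sameCycle h
    lia

theorem numCycles_add_le_of_mul_swap {σ τ : Equiv.Perm α} {a b : α} (hab : a ≠ b)
    (hτ : τ.SameCycle a b)
    (h : numCycles σ + numCycles (τ * Equiv.swap a b) + numCycles (σ * (τ * Equiv.swap a b)) ≤
      Fintype.card α + 2 * Nat.card (Quotient (jointOrbits σ (τ * Equiv.swap a b)))) :
    numCycles σ + numCycles τ + numCycles (σ * τ) ≤
      Fintype.card α + 2 * Nat.card (Quotient (jointOrbits σ τ)) := by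
  set τ' := τ * Equiv.swap a b with τ'_def
  have prod_eq : σ * τ = σ * τ' * Equiv.swap a b := by simp [τ'_def, mul_assoc]
  have orbits_eq : jointOrbits σ τ =
      jointOrbits σ τ' ⊔ Equiv.Perm.SameCycle.setoid (Equiv.swap a b) := by
    have := jointOrbits_mul_left τ (Equiv.swap a b)
    rw [jointOrbits, jointOrbits,
      sup_eq_left (a := Equiv.Perm.SameCycle.setoid τ) |>.2 (setoid_sameCycle_swap_le_iff.2 hτ)]
      at this
    rw [jointOrbits, jointOrbits, sup_assoc, this]
  have splits := numCycles_mul_swap_of_sameCycle hab hτ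
  by_cases hj : jointOrbits σ τ' a b
  · have := numCycles_mul_swap_le (σ * τ') hab
    rw [orbits_eq, sup_eq_left.2 (setoid_sameCycle_swap_le_iff.2 hj), prod_eq]
    lia
  · have merges := numCycles_mul_swap_of_not_sameCycle
      fun hab => hj (setoid_sameCycle_mul_le σ τ' hab)
    have := card_quotient_sup_swap hj
    rw [← orbits_eq] at this
    rw [← prod_eq] at merges
    lia

/-- The Riemann–Hurwitz inequality for the covering of the sphere with monodromies `σ`, `τ`,
`(σ τ)⁻¹`. -/
theorem numCycles_add_le (σ τ : Equiv.Perm α) :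
    numCycles σ + numCycles τ + numCycles (σ * τ) ≤
      Fintype.card α + 2 * Nat.card (Quotient (jointOrbits σ τ)) := by
  induction hk : Fintype.card α - numCycles τ using Nat.strong_induction_on generalizing τ with
  | _ k ih =>
    by_cases hτ : τ = 1
    · rw [hτ, jointOrbits, setoid_sameCycle_one, sup_bot_eq, ← numCycles_eq_card_quotient,
        numCycles_one, mul_one]
      lia
    · obtain ⟨a, ha⟩ : ∃ a, τ a ≠ a := by
        by_contra! h
        exact hτ (Equiv.ext h)
      have hsc : τ.SameCycle a (τ a) := ⟨1, by simp⟩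
      have splits := numCycles_mul_swap_of_sameCycle ha.symm hsc
      have := numCycles_le (τ * Equiv.swap a (τ a))
      exact numCycles_add_le_of_mul_swap ha.symm hsc (ih _ (by lia) _ rfl)

theorem numCycles_add_le_of_transitive [Nonempty α] {σ τ : Equiv.Perm α}
    (h : jointOrbits σ τ = ⊤) :
    numCycles σ + numCycles τ + numCycles (σ * τ) ≤ Fintype.card α + 2 := by
  simpa [h, card_quotient_top] using numCycles_add_le σ τ

end Genus

/-! ### The genus expansion of finite free cumulants -/

theorem prod_map_mul_pow_pred {M : Type*} [CommMonoid M] (u : ℕ → M) (r : M) {m : Multiset ℕ}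
    (hm : ∀ k ∈ m, 0 < k) :
    (m.map fun k => u k * r ^ (k - 1)).prod = (m.map u).prod * r ^ (m.sum - m.card) := by
  induction m using Multiset.induction with
  | empty => simp
  | cons k m ih =>
    have hk := hm k (Multiset.mem_cons_self k m)
    have hm' : ∀ j ∈ m, 0 < j := fun j hj => hm j (Multiset.mem_cons_of_mem hj)
    have card_le : m.card ≤ m.sum := by
      simpa using Multiset.card_nsmul_le_sum (a := 1) hm'
    have exponent : k + m.sum - (m.card + 1) = (k - 1) + (m.sum - m.card) := by lia
    rw [Multiset.map_cons, Multiset.prod_cons, ih hm', Multiset.map_cons, Multiset.prod_cons,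
      Multiset.sum_cons, Multiset.card_cons, exponent, pow_add, mul_mul_mul_comm]

theorem cycleProd_mul_pow_pred {α M : Type*} [Fintype α] [DecidableEq α] [CommMonoid M]
    (u : ℕ → M) (r : M) (σ : Equiv.Perm α) :
    cycleProd (fun k => u k * r ^ (k - 1)) σ =
      cycleProd u σ * r ^ (Fintype.card α - numCycles σ) := by
  rw [cycleProd, prod_map_mul_pow_pred u r fun _ => σ.partition.parts_pos, σ.partition.parts_sum,
    cycleProd, numCycles]

section SeqCumulant

variable {K : Type*} [Field K]

/-- The finite free cumulants of degree `d` as a function of the normalised coefficients `a`. -/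
noncomputable def seqCumulant (d : K) (a : ℕ → K) (n : ℕ) : K :=
  (-d) ^ (n - 1) / (n - 1).factorial *
    partitionSum moebiusWeight a (Finset.univ : Finset (Fin n))

theorem finiteCumulant_eq_seqCumulant (d : ℕ) (p : ℝ[X]) (n : ℕ) :
    finiteCumulant d p n = seqCumulant (d : ℝ) (normCoeff d p) n := rfl

theorem IsExpSeq.seqCumulant_eq {a c : ℕ → K} (h0 : a 0 = 1) (h : IsExpSeq a c) (d : K) {n : ℕ}
    (hn : 1 ≤ n) :
    seqCumulant d a n = (-d) ^ (n - 1) / (n - 1).factorial * c n := by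
  rw [seqCumulant, h.partitionSum_moebiusWeight h0 ⟨⟨0, hn⟩, Finset.mem_univ _⟩]
  simp

theorem neg_pow_mul_neg_one_div_pow {d : K} (hd : d ≠ 0) (m : ℕ) :
    (-d) ^ m * (-1 / d) ^ m = 1 := by
  rw [← mul_pow, mul_div_assoc', neg_mul_neg, mul_one, div_self hd, one_pow]

variable [CharZero K]

theorem permSum_seqCumulant {d : K} (hd : d ≠ 0) {a : ℕ → K} (h0 : a 0 = 1) (n : ℕ) :
    permSum (Fin n) (fun k => seqCumulant d a k * (-1 / d) ^ (k - 1)) = a n := by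
  refine congrFun ((isExpSeq_permSum _).exp_unique ?_
    ((isExpSeq_logSeq h0).congr_log fun k hk => ?_)) n
  · rw [permSum_of_isEmpty, h0]
  · have hf : ((k - 1).factorial : K) ≠ 0 := Nat.cast_ne_zero.2 (Nat.factorial_ne_zero _)
    rw [(isExpSeq_logSeq h0).seqCumulant_eq h0 d hk]
    field_simp
    linear_combination -(logSeq a k) * neg_pow_mul_neg_one_div_pow hd (k - 1)

theorem seqCumulant_mul {d : K} (hd : d ≠ 0) {a b : ℕ → K} (ha : a 0 = 1) (hb : b 0 = 1)
    {n : ℕ} (hn : 1 ≤ n) :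
    seqCumulant d (fun k => a k * b k) n = 1 / (n - 1).factorial *
      ∑ q ∈ transitivePairs (Fin n), (-1 / d) ^ (n + 1 - numCycles q.1 - numCycles q.2) *
        (cycleProd (seqCumulant d a) q.1 * cycleProd (seqCumulant d b) q.2) := by
  have h := isExpSeq_permSum_mul_permSum (fun k => seqCumulant d a k * (-1 / d) ^ (k - 1))
    (fun k => seqCumulant d b k * (-1 / d) ^ (k - 1))
  simp only [permSum_seqCumulant hd ha, permSum_seqCumulant hd hb] at h
  rw [h.seqCumulant_eq (by rw [ha, hb, one_mul]) d hn, transitiveSum, div_mul_eq_mul_div,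
    div_mul_eq_mul_div, one_mul, Finset.mul_sum]
  congr 1
  refine Finset.sum_congr rfl fun q hq => ?_
  have : Nonempty (Fin n) := ⟨⟨0, hn⟩⟩
  have genus := numCycles_add_le_of_transitive (mem_transitivePairs.1 hq)
  have := numCycles_pos (q.1 * q.2)
  have le_left := numCycles_le q.1
  have le_right := numCycles_le q.2
  rw [Fintype.card_fin] at genus le_left le_right
  have exponent : (n - numCycles q.1) + (n - numCycles q.2) =
      (n - 1) + (n + 1 - numCycles q.1 - numCycles q.2) := by lia
  rw [cycleProd_mul_pow_pred, cycleProd_mul_pow_pred, Fintype.card_fin, mul_mul_mul_comm,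
    ← pow_add, exponent, pow_add]
  linear_combination ((-1 / d) ^ (n + 1 - numCycles q.1 - numCycles q.2) *
    (cycleProd (seqCumulant d a) q.1 * cycleProd (seqCumulant d b) q.2)) *
      neg_pow_mul_neg_one_div_pow hd (n - 1)

end SeqCumulant

/-! ### Non-crossing partitions as geodesic permutations -/

section ArcInvariant

variable {n : ℕ}

/-- `z` lies strictly between `x` and `y` in the cyclic order; the open arc from `x` to `x` is the
complement of `x`. -/
def Between (x z y : Fin n) : Prop := (x < z ∧ z < y) ∨ (z < y ∧ y ≤ x) ∨ (y ≤ x ∧ x < z)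

/-- The open arcs from `x` to `σ x` are `σ`-invariant. This is non-crossing-ness, expressed in
terms of the permutation. -/
def ArcInvariant (σ : Equiv.Perm (Fin n)) : Prop :=
  ∀ x z, Between x z (σ x) ↔ Between x (σ z) (σ x)

theorem not_between_left (x y : Fin n) : ¬Between x x y := by
  simp only [Between]
  lia

theorem not_between_right (x y : Fin n) : ¬Between x y y := by
  simp only [Between]
  lia

theorem finRotate_val_cases (i : Fin n) :
    (finRotate n i : ℕ) = i + 1 ∨ (i : ℕ) + 1 = n ∧ (finRotate n i : ℕ) = 0 := by
  obtain _ | n := n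
  · exact i.elim0
  · rcases eq_or_ne i (Fin.last n) with rfl | h
    · simp
    · exact .inl (coe_finRotate_of_ne_last h)

theorem not_between_finRotate (x z : Fin n) : ¬Between x z (finRotate n x) := by
  have := finRotate_val_cases x
  simp only [Between, Fin.lt_def, Fin.le_def]
  lia

theorem between_finRotate_iff {x i y : Fin n} (hx : x ≠ i) (hy : y ≠ finRotate n i) :
    Between x (finRotate n i) y ↔ Between x i y := by
  have := finRotate_val_cases i
  simp only [Between, Fin.lt_def, Fin.le_def, ne_eq, Fin.ext_iff] at *
  lia

theorem arcInvariant_finRotate : ArcInvariant (finRotate n) := fun x _ =>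
  iff_of_false (not_between_finRotate x _) (not_between_finRotate x _)

namespace ArcInvariant

variable {σ : Equiv.Perm (Fin n)} {i j : Fin n}

theorem between_iff (h : ArcInvariant σ) (hij : σ.SameCycle i j) (x : Fin n) :
    Between x i (σ x) ↔ Between x j (σ x) := by
  have : Equiv.Perm.SameCycle.setoid σ ≤ Setoid.ker fun z => Between x z (σ x) :=
    setoid_sameCycle_le_iff.2 fun z => propext (h x z)
  exact iff_of_eq (this hij)

theorem between_mul_swap_iff (h : ArcInvariant σ) {x : Fin n}
    (hx : Between x i (σ x) ↔ Between x j (σ x)) (z : Fin n) :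
    Between x z (σ x) ↔ Between x (σ (Equiv.swap i j z)) (σ x) := by
  rw [← h]
  rcases eq_or_ne z i with rfl | hzi
  · rwa [Equiv.swap_apply_left]
  rcases eq_or_ne z j with rfl | hzj
  · rw [Equiv.swap_apply_right, hx]
  · rw [Equiv.swap_apply_of_ne_of_ne hzi hzj]

theorem mul_swap_of_apply_right (h : ArcInvariant σ) (hij : i ≠ j) (hj : σ j = finRotate n i) :
    ArcInvariant (σ * Equiv.swap i j) := by
  have hi : σ i ≠ finRotate n i := fun e => hij (σ.injective (e.trans hj.symm))
  intro x z
  rw [Equiv.Perm.mul_apply, Equiv.Perm.mul_apply]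
  rcases eq_or_ne x i with rfl | hxi
  · rw [Equiv.swap_apply_left, hj]
    exact iff_of_false (not_between_finRotate x _) (not_between_finRotate x _)
  rcases eq_or_ne x j with rfl | hxj
  · have arc_inter (w : Fin n) : Between x w (σ i) ↔ Between x w (σ x) ∧ Between i w (σ i) := by
      have := finRotate_val_cases i
      have between_j : Between i x (σ i) := by
        rw [h i x, hj]
        simp only [Between, Fin.lt_def, Fin.le_def, ne_eq, Fin.ext_iff] at *
        lia
      rw [hj]
      simp only [Between, Fin.lt_def, Fin.le_def, ne_eq, Fin.ext_iff] at *
      lia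
    rw [Equiv.swap_apply_right]
    rcases eq_or_ne z i with rfl | hzi
    · simp [arc_inter, not_between_left, not_between_right]
    rcases eq_or_ne z x with rfl | hzx
    · simp [not_between_left, not_between_right]
    · rw [Equiv.swap_apply_of_ne_of_ne hzi hzx, arc_inter, arc_inter, ← h x z, ← h i z]
  · rw [Equiv.swap_apply_of_ne_of_ne hxi hxj]
    refine h.between_mul_swap_iff ?_ z
    rw [h x j, hj, between_finRotate_iff hxi fun e => hxj (σ.injective (e.trans hj.symm))]

theorem mul_swap_of_apply_left (h : ArcInvariant σ) (hsc : σ.SameCycle i j)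
    (hij : i ≠ j) (hi : σ i = finRotate n i) : ArcInvariant (σ * Equiv.swap i j) := by
  have hg := finRotate_val_cases i
  have hj : σ j ≠ finRotate n i := fun e => hij (σ.injective (hi.trans e.symm))
  have not_between : ¬Between j i (σ j) := by
    rw [h.between_iff hsc]
    exact not_between_left _ _
  have arc_union (z : Fin n) :
      Between i z (σ j) ↔ ¬Between j z (finRotate n i) ∨ Between j z (σ j) := by
    simp only [Between, Fin.lt_def, Fin.le_def, ne_eq, Fin.ext_iff] at *
    lia
  have outer_arc (z : Fin n) : Between j z (finRotate n i) ↔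
      Between j (σ (Equiv.swap i j z)) (finRotate n i) := by
    rcases eq_or_ne z i with rfl | hzi
    · rw [Equiv.swap_apply_left]
      simp only [Between, Fin.lt_def, Fin.le_def, ne_eq, Fin.ext_iff] at *
      lia
    rcases eq_or_ne z j with rfl | hzj
    · simp [hi, not_between_left, not_between_right]
    · rw [Equiv.swap_apply_of_ne_of_ne hzi hzj]
      have hσz : σ z ≠ finRotate n i := fun e => hzi (σ.injective (e.trans hi.symm))
      have same_side := h.between_iff hsc z
      simp only [Between, Fin.lt_def, Fin.le_def, ne_eq, Fin.ext_iff] at *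
      lia
  intro x z
  rw [Equiv.Perm.mul_apply, Equiv.Perm.mul_apply]
  rcases eq_or_ne x i with rfl | hxi
  · rw [Equiv.swap_apply_left, arc_union, arc_union, ← outer_arc z,
      h.between_mul_swap_iff (h.between_iff hsc j)]
  rcases eq_or_ne x j with rfl | hxj
  · rw [Equiv.swap_apply_right, hi]
    exact outer_arc z
  · rw [Equiv.swap_apply_of_ne_of_ne hxi hxj]
    exact h.between_mul_swap_iff (h.between_iff hsc x) z

theorem not_sameCycle (h : ArcInvariant σ) (hij : i ≠ j) (hj : σ j = finRotate n i) :
    ¬σ.SameCycle i j := by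
  intro hsc
  have not_between : ¬Between i (finRotate n i) (σ i) := by
    rw [← hj, ← h i j, ← h.between_iff hsc]
    exact not_between_left _ _
  have hi : σ i ≠ finRotate n i := fun e => hij (σ.injective (e.trans hj.symm))
  have := finRotate_val_cases i
  simp only [Between, Fin.lt_def, Fin.le_def, ne_eq, Fin.ext_iff] at *
  lia

end ArcInvariant

end ArcInvariant

section Geodesic

theorem numCycles_inv_mul_swap_mul {α : Type*} [Fintype α] [DecidableEq α] {σ c : Equiv.Perm α}
    {i j : α} (hij : i ≠ j) (hj : σ j = c i) :
    numCycles ((σ * Equiv.swap i j)⁻¹ * c) = numCycles (σ⁻¹ * c) + 1 := by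
  have apply_i : (σ⁻¹ * c) i = j := by simp [← hj]
  have eq_mul_swap : (σ * Equiv.swap i j)⁻¹ * c =
      σ⁻¹ * c * Equiv.swap ((σ⁻¹ * c)⁻¹ i) i := by
    rw [mul_inv_rev, Equiv.swap_inv, mul_assoc, Equiv.swap_mul_eq_mul_swap, ← apply_i]
    simp
  rw [eq_mul_swap, numCycles_mul_swap_of_sameCycle _ ⟨1, by simp⟩]
  rw [ne_eq, Equiv.Perm.inv_eq_iff_eq, apply_i]
  exact hij

/-- Each step splits a cycle of `σ⁻¹ * c`. -/
theorem induction_mul_swap {α : Type*} [Finite α] [DecidableEq α] {c : Equiv.Perm α}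
    {P : Equiv.Perm α → Prop} (base : P c)
    (step : ∀ (σ : Equiv.Perm α) (i j : α), i ≠ j → σ j = c i → P (σ * Equiv.swap i j) → P σ)
    (σ : Equiv.Perm α) : P σ := by
  have := Fintype.ofFinite α
  induction hk : Fintype.card α - numCycles (σ⁻¹ * c) using Nat.strong_induction_on
    generalizing σ with
  | _ k ih =>
    by_cases hσ : σ = c
    · rwa [hσ]
    · obtain ⟨i, hi⟩ : ∃ i, σ i ≠ c i := by
        by_contra! h
        exact hσ (Equiv.ext h)
      have hj : σ (σ⁻¹ (c i)) = c i := by simp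
      have hij : i ≠ σ⁻¹ (c i) := fun e => hi (by rwa [← e] at hj)
      have splits := numCycles_inv_mul_swap_mul hij hj
      have := numCycles_le ((σ * Equiv.swap i (σ⁻¹ (c i)))⁻¹ * c)
      exact step σ i _ hij hj (ih _ (by lia) _ rfl)

variable {n : ℕ}

theorem setoid_sameCycle_finRotate : Equiv.Perm.SameCycle.setoid (finRotate n) = ⊤ := by
  refine Setoid.eq_top_iff.2 fun x y => ?_
  rcases n with _ | _ | n
  · exact x.elim0
  · exact Subsingleton.elim (α := Fin 1) x y ▸ .refl _ _
  · have moved (z : Fin (n + 2)) : finRotate (n + 2) z ≠ z := by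
      rw [← Equiv.Perm.mem_support, support_finRotate]
      exact Finset.mem_univ z
    exact isCycle_finRotate.sameCycle (moved x) (moved y)

theorem numCycles_finRotate [NeZero n] : numCycles (finRotate n) = 1 :=
  numCycles_eq_one_iff.2 setoid_sameCycle_finRotate

/-- `σ` lies on a geodesic from the identity to the long cycle, for the word length with respect to
transpositions. -/
def IsGeodesic (σ : Equiv.Perm (Fin n)) : Prop :=
  numCycles σ + numCycles (σ⁻¹ * finRotate n) = n + 1

theorem isGeodesic_finRotate [NeZero n] : IsGeodesic (finRotate n) := by
  rw [IsGeodesic, inv_mul_cancel, numCycles_one, numCycles_finRotate, Fintype.card_fin, add_comm]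

theorem numCycles_add_numCycles_inv_mul_finRotate_le [NeZero n] (σ : Equiv.Perm (Fin n)) :
    numCycles σ + numCycles (σ⁻¹ * finRotate n) ≤ n + 1 := by
  have transitive : jointOrbits σ (σ⁻¹ * finRotate n) = ⊤ := by
    rw [← jointOrbits_mul_right, mul_inv_cancel_left, jointOrbits, setoid_sameCycle_finRotate,
      sup_top_eq]
  have := numCycles_add_le_of_transitive transitive
  rw [mul_inv_cancel_left, numCycles_finRotate, Fintype.card_fin] at this
  lia

theorem ArcInvariant.isGeodesic [NeZero n] {σ : Equiv.Perm (Fin n)} :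
    ArcInvariant σ → IsGeodesic σ := by
  induction σ using induction_mul_swap with
  | base => exact fun _ => isGeodesic_finRotate
  | step σ i j hij hj ih =>
    intro h
    have geodesic := ih (h.mul_swap_of_apply_right hij hj)
    have splits := numCycles_inv_mul_swap_mul hij hj
    have merges := numCycles_mul_swap_of_not_sameCycle (h.not_sameCycle hij hj)
    rw [IsGeodesic] at geodesic ⊢
    lia

theorem IsGeodesic.arcInvariant [NeZero n] {σ : Equiv.Perm (Fin n)} :
    IsGeodesic σ → ArcInvariant σ := by
  induction σ using induction_mul_swap with
  | base => exact fun _ => arcInvariant_finRotate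
  | step σ i j hij hj ih =>
    intro h
    have splits := numCycles_inv_mul_swap_mul hij hj
    have hle := numCycles_add_numCycles_inv_mul_finRotate_le (σ * Equiv.swap i j)
    have hσ : ¬σ.SameCycle i j := fun hsc => by
      have := numCycles_mul_swap_of_sameCycle hij hsc
      rw [IsGeodesic] at h
      lia
    have merges := numCycles_mul_swap_of_not_sameCycle hσ
    have geodesic : IsGeodesic (σ * Equiv.swap i j) := by
      rw [IsGeodesic] at h ⊢
      lia
    have cancel : σ * Equiv.swap i j * Equiv.swap i j = σ := by
      rw [mul_assoc, Equiv.swap_mul_self, mul_one]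
    have hsc : (σ * Equiv.swap i j).SameCycle i j := by
      by_contra hsc
      have := numCycles_mul_swap_of_not_sameCycle hsc
      rw [cancel] at this
      lia
    rw [← cancel]
    exact (ih geodesic).mul_swap_of_apply_left hsc hij (by simp [hj])

end Geodesic

section NonCrossing

variable {n : ℕ}

theorem mem_part_cyclePartition {σ : Equiv.Perm (Fin n)} {x y : Fin n} :
    y ∈ (cyclePartition σ).part x ↔ σ.SameCycle x y := by
  classical
  exact Finpartition.mem_part_ofSetoid_iff_rel

theorem not_between_blockCycle {V : Finset (Fin n)} {x z : Fin n} (hx : x ∈ V) (hz : z ∈ V) :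
    ¬Between x z (blockCycle V x) := by
  have mono := V.sortedLT_sort.strictMono_get
  obtain ⟨k, rfl⟩ := List.get_of_mem ((Finset.mem_sort (s := V) (· ≤ ·)).2 hx)
  obtain ⟨m, rfl⟩ := List.get_of_mem ((Finset.mem_sort (s := V) (· ≤ ·)).2 hz)
  have next : blockCycle V ((V.sort (· ≤ ·)).get k) =
      (V.sort (· ≤ ·)).get (finRotate _ k) := by
    have val_eq : (finRotate _ k : ℕ) = (k + 1) % (V.sort (· ≤ ·)).length := by
      have := k.neZero
      rw [finRotate_apply, Fin.val_add, Fin.val_one', Nat.add_mod_mod]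
    simp only [blockCycle, List.get_eq_getElem, val_eq]
    exact List.formPerm_apply_getElem _ (V.sort_nodup _) k k.2
  rw [next]
  have := not_between_finRotate k m
  simpa only [Between, mono.lt_iff_lt, mono.le_iff_le] using this

theorem eq_of_not_between {V : Finset (Fin n)} {x y y' : Fin n} (hy : y ∈ V) (hy' : y' ∈ V)
    (h : ∀ z ∈ V, ¬Between x z y) (h' : ∀ z ∈ V, ¬Between x z y') : y = y' := by
  have h1 := h y' hy'
  have h2 := h' y hy
  simp only [Between] at h1 h2
  lia

theorem part_cyclePartition_eq_iff {σ : Equiv.Perm (Fin n)} {x y : Fin n} :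
    (cyclePartition σ).part x = (cyclePartition σ).part y ↔ σ.SameCycle x y := by
  rw [← mem_part_cyclePartition, eq_comm,
    Finpartition.mem_part_iff_part_eq_part _ (Finset.mem_univ y) (Finset.mem_univ x)]

theorem isNonCrossing_iff {π : SetPartition n} :
    IsNonCrossing π ↔ ∀ a b c d, a < b → b < c → c < d →
      π.part a = π.part c → π.part b = π.part d → π.part a = π.part b := by
  have self_mem (x : Fin n) : x ∈ π.part x := π.mem_part (Finset.mem_univ x)
  have part_mem (x : Fin n) : π.part x ∈ π.parts := π.part_mem.2 (Finset.mem_univ x)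
  constructor
  · intro h a b c d hab hbc hcd hac hbd
    exact h _ (part_mem a) _ (part_mem b) a b c d hab hbc hcd (self_mem a) (hac ▸ self_mem c)
      (self_mem b) (hbd ▸ self_mem d)
  · intro h V hV W hW a b c d hab hbc hcd ha hc hb hd
    rw [← π.part_eq_of_mem hV ha, ← π.part_eq_of_mem hW hb]
    exact h a b c d hab hbc hcd
      (by rw [π.part_eq_of_mem hV ha, π.part_eq_of_mem hV hc])
      (by rw [π.part_eq_of_mem hW hb, π.part_eq_of_mem hW hd])

theorem IsNonCrossing.between_of_between {π : SetPartition n} (h : IsNonCrossing π)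
    {x y z w : Fin n} (hxy : π.part x = π.part y) (hzw : π.part z = π.part w)
    (hxz : π.part x ≠ π.part z) (hB : Between x z y) : Between x w y := by
  rw [isNonCrossing_iff] at h
  have hxw : x ≠ w := by grind
  have hyw : y ≠ w := by grind
  by_contra hw
  simp only [Between] at hB hw
  grind

theorem toPerm_mem_part (π : SetPartition n) (x : Fin n) : toPerm π x ∈ π.part x :=
  blockCycle_mem (π.mem_part (Finset.mem_univ x))

theorem part_toPerm (π : SetPartition n) (x : Fin n) : π.part (toPerm π x) = π.part x :=
  part_eq_of_mem_part π (toPerm_mem_part π x)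

theorem not_between_toPerm (π : SetPartition n) {x z : Fin n} (hz : z ∈ π.part x) :
    ¬Between x z (toPerm π x) :=
  not_between_blockCycle (π.mem_part (Finset.mem_univ x)) hz

theorem IsNonCrossing.arcInvariant {π : SetPartition n} (h : IsNonCrossing π) :
    ArcInvariant (toPerm π) := by
  intro x z
  by_cases hz : z ∈ π.part x
  · refine iff_of_false (not_between_toPerm π hz) (not_between_toPerm π ?_)
    rw [← part_eq_of_mem_part π hz]
    exact toPerm_mem_part π z
  · have hxz : π.part x ≠ π.part z := fun e => hz (e ▸ π.mem_part (Finset.mem_univ z))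
    exact ⟨h.between_of_between (part_toPerm π x).symm (part_toPerm π z).symm hxz,
      h.between_of_between (part_toPerm π x).symm (part_toPerm π z) (by rwa [part_toPerm])⟩

theorem ArcInvariant.toPerm_cyclePartition {σ : Equiv.Perm (Fin n)} (h : ArcInvariant σ) :
    toPerm (cyclePartition σ) = σ := by
  ext1 x
  refine eq_of_not_between (x := x) (toPerm_mem_part _ x)
    (mem_part_cyclePartition.2 ⟨1, by simp⟩) (fun z hz => not_between_toPerm _ hz) fun z hz => ?_
  rw [← h.between_iff (mem_part_cyclePartition.1 hz) x]
  exact not_between_left _ _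

theorem ArcInvariant.isNonCrossing {σ : Equiv.Perm (Fin n)} (h : ArcInvariant σ) :
    IsNonCrossing (cyclePartition σ) := by
  rw [isNonCrossing_iff]
  simp only [part_cyclePartition_eq_iff]
  intro a b c d hab hbc hcd hac hbd
  by_contra hne
  classical
  obtain ⟨x, hx, last⟩ := Finset.exists_max_image
    (Finset.univ.filter fun y => σ.SameCycle a y ∧ y < b) id
    ⟨a, by simp [hab, Equiv.Perm.SameCycle.rfl]⟩
  simp only [Finset.mem_filter, Finset.mem_univ, true_and, id_eq, and_imp] at hx last
  have hσx : σ.SameCycle a (σ x) := hx.1.apply_right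
  have hc : ¬Between x c (σ x) := by
    rw [← h.between_iff (hx.1.symm.trans hac) x]
    exact not_between_left _ _
  have hbd := h.between_iff hbd x
  have hb : σ x ≠ b := fun e => hne (e ▸ hσx)
  have := last _ hσx
  simp only [Between] at hc hbd
  lia

theorem sameCycle_toPerm_iff {π : SetPartition n} {x y : Fin n} :
    (toPerm π).SameCycle x y ↔ π.part x = π.part y := by
  constructor
  · have : Equiv.Perm.SameCycle.setoid (toPerm π) ≤ Setoid.ker π.part :=
      setoid_sameCycle_le_iff.2 fun z => (part_toPerm π z).symm
    exact fun h => this h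
  · intro hxy
    have le : Equiv.Perm.SameCycle.setoid (blockCycle (π.part x)) ≤
        Equiv.Perm.SameCycle.setoid (toPerm π) := by
      refine setoid_sameCycle_le_iff.2 fun z => ?_
      by_cases hz : z ∈ π.part x
      · rw [← part_eq_of_mem_part π hz]
        exact (Equiv.Perm.SameCycle.refl _ z).apply_right
      · rw [blockCycle, List.formPerm_apply_of_notMem (by simpa using hz)]
    have hy : y ∈ π.part x := hxy ▸ π.mem_part (Finset.mem_univ y)
    exact le (((π.part x).sort_nodup (· ≤ ·)).isCycleOn_formPerm.2
      (by simp) (by simpa using hy))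

theorem finpartition_eq_of_part_eq {α : Type*} [DecidableEq α] {s : Finset α}
    {P Q : Finpartition s} (h : ∀ x ∈ s, P.part x = Q.part x) : P = Q := by
  have parts_le {P Q : Finpartition s} (h : ∀ x ∈ s, P.part x = Q.part x) :
      P.parts ⊆ Q.parts := fun V hV => by
    obtain ⟨x, hx, rfl⟩ := P.part_surjOn hV
    exact h x hx ▸ Q.part_mem.2 hx
  exact Finpartition.ext ((parts_le h).antisymm (parts_le fun x hx => (h x hx).symm))

theorem cyclePartition_toPerm (π : SetPartition n) : cyclePartition (toPerm π) = π := by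
  refine finpartition_eq_of_part_eq fun x _ => ?_
  ext y
  rw [mem_part_cyclePartition, sameCycle_toPerm_iff, eq_comm,
    Finpartition.mem_part_iff_part_eq_part _ (Finset.mem_univ y) (Finset.mem_univ x)]

open Classical in
/-- Biane's bijection between non-crossing partitions and geodesic permutations. -/
theorem sum_isGeodesic [NeZero n] {M : Type*} [AddCommMonoid M] (g : Equiv.Perm (Fin n) → M) :
    ∑ σ with IsGeodesic σ, g σ = ∑ π ∈ NC n, g (toPerm π) := by
  refine Finset.sum_nbij' cyclePartition toPerm ?_ ?_ ?_ (fun π _ => cyclePartition_toPerm π) ?_ <;>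
    simp only [NC, Finset.mem_filter, Finset.mem_univ, true_and]
  · exact fun σ hσ => hσ.arcInvariant.isNonCrossing
  · exact fun π hπ => hπ.arcInvariant.isGeodesic
  · exact fun σ hσ => hσ.arcInvariant.toPerm_cyclePartition
  · exact fun σ hσ => by rw [hσ.arcInvariant.toPerm_cyclePartition]

end NonCrossing

/-! ### Sums over factorizations of a permutation -/

theorem jointOrbits_inv_mul {α : Type*} (σ c : Equiv.Perm α) :
    jointOrbits σ (σ⁻¹ * c) = jointOrbits σ c := by
  rw [← jointOrbits_mul_right, mul_inv_cancel_left]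

section FactorSum

variable {α β : Type*} [Fintype α] [DecidableEq α] [Fintype β] [DecidableEq β]
variable {R : Type*} [CommSemiring R] (u v : ℕ → R) (k : ℕ)

open Classical in
/-- The sum of `u_σ v_τ` over the factorizations `c = σ τ` for which `⟨σ, τ⟩` is transitive and `σ`
and `τ` have `k` cycles together. -/
noncomputable def factorSum (c : Equiv.Perm α) : R :=
  ∑ σ with jointOrbits σ (σ⁻¹ * c) = ⊤ ∧ numCycles σ + numCycles (σ⁻¹ * c) = k,
    cycleProd u σ * cycleProd v (σ⁻¹ * c)

theorem factorSum_permCongr (e : α ≃ β) (c : Equiv.Perm α) :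
    factorSum u v k (e.permCongr c) = factorSum u v k c := by
  have permCongr_inv_mul (σ : Equiv.Perm α) :
      (e.permCongr σ)⁻¹ * e.permCongr c = e.permCongr (σ⁻¹ * c) := by
    ext x
    simp [Equiv.permCongr_def, Equiv.Perm.inv_def]
  refine (Finset.sum_equiv e.permCongr (fun σ => ?_) fun σ _ => ?_).symm
  · simp only [Finset.mem_filter, Finset.mem_univ, true_and, permCongr_inv_mul,
      numCycles_permCongr, jointOrbits_permCongr_eq_top_iff]
  · rw [permCongr_inv_mul, cycleProd_permCongr, cycleProd_permCongr]

theorem factorSum_congr {c c' : Equiv.Perm α} (h : c.partition.parts = c'.partition.parts) :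
    factorSum u v k c = factorSum u v k c' := by
  obtain ⟨ρ, rfl⟩ := isConj_iff.1 (Equiv.Perm.partition_eq_of_isConj.2 (Nat.Partition.ext h))
  exact (factorSum_permCongr u v k ρ c).symm

theorem sum_transitivePairs_eq_sum_factorSum :
    ∑ q ∈ transitivePairs α with numCycles q.1 + numCycles q.2 = k,
      cycleProd u q.1 * cycleProd v q.2 = ∑ c : Equiv.Perm α, factorSum u v k c := by
  simp only [factorSum, Finset.sum_sigma']
  refine Finset.sum_nbij' (fun q => ⟨q.1 * q.2, q.1⟩) (fun z => (z.2, z.2⁻¹ * z.1))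
    ?_ ?_ ?_ ?_ ?_ <;> simp [mem_transitivePairs]

variable {u v k} in
theorem le_and_even_of_factorSum_ne_zero [Nonempty α] {c : Equiv.Perm α}
    (h : factorSum u v k c ≠ 0) :
    k + numCycles c ≤ Fintype.card α + 2 ∧ Even (Fintype.card α + (k + numCycles c)) := by
  classical
  obtain ⟨σ, hσ, -⟩ := Finset.exists_ne_zero_of_sum_ne_zero h
  obtain ⟨transitive, rfl⟩ := (Finset.mem_filter.1 hσ).2
  have genus := numCycles_add_le_of_transitive transitive
  have parity := even_card_add_numCycles σ (σ⁻¹ * c)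
  rw [mul_inv_cancel_left] at genus parity
  exact ⟨genus, parity⟩

end FactorSum

theorem parts_partition_finRotate {n : ℕ} [NeZero n] : (finRotate n).partition.parts = {n} := by
  rw [parts_partition_of_setoid_eq_top setoid_sameCycle_finRotate, Fintype.card_fin]

open Classical in
theorem factorSum_finRotate (u v : ℕ → ℝ) {n : ℕ} [NeZero n] :
    factorSum u v (n + 1) (finRotate n) =
      ∑ π ∈ NC n, prodOver u π * prodOver v (kreweras π) := by
  have transitive (σ : Equiv.Perm (Fin n)) : jointOrbits σ (finRotate n) = ⊤ := by
    rw [jointOrbits, setoid_sameCycle_finRotate, sup_top_eq]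
  have geodesics := sum_isGeodesic fun σ => cycleProd u σ * cycleProd v (σ⁻¹ * finRotate n)
  simp only [cycleProd_eq_prodOver, cyclePartition_toPerm, ← kreweras.eq_1] at geodesics
  rw [← geodesics]
  simp only [factorSum, jointOrbits_inv_mul, transitive, true_and, cycleProd_eq_prodOver]
  refine Finset.sum_congr (Finset.ext fun σ => ?_) fun _ _ => rfl
  rw [Finset.mem_filter, Finset.mem_filter, IsGeodesic]

theorem sum_transitivePairs_numCycles_eq_succ (u v : ℕ → ℝ) {n : ℕ} [NeZero n] :
    ∑ q ∈ transitivePairs (Fin n) with numCycles q.1 + numCycles q.2 = n + 1,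
      cycleProd u q.1 * cycleProd v q.2 =
        (n - 1).factorial * ∑ π ∈ NC n, prodOver u π * prodOver v (kreweras π) := by
  classical
  rw [sum_transitivePairs_eq_sum_factorSum, ← factorSum_finRotate,
    ← card_setoid_sameCycle_eq_top NeZero.one_le, ← nsmul_eq_mul, ← Finset.sum_const]
  symm
  refine Finset.sum_subset_zero_on_sdiff (Finset.subset_univ _) (fun c hc => ?_) fun c hc => ?_
  · by_contra h
    have genus := (le_and_even_of_factorSum_ne_zero h).1
    have := numCycles_pos c
    rw [Fintype.card_fin] at genus
    simp only [Finset.mem_sdiff, Finset.mem_univ, Finset.mem_filter, true_and] at hc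
    exact hc (numCycles_eq_one_iff.1 (by lia))
  · refine factorSum_congr u v _ ?_
    rw [parts_partition_finRotate, parts_partition_of_setoid_eq_top (Finset.mem_filter.1 hc).2,
      Fintype.card_fin]

theorem isPretransitive_closure_pair_iff {α : Type*} (σ τ : Equiv.Perm α) :
    MulAction.IsPretransitive (Subgroup.closure ({σ, τ} : Set (Equiv.Perm α))) α ↔
      jointOrbits σ τ = ⊤ := by
  set G := Subgroup.closure ({σ, τ} : Set (Equiv.Perm α)) with hG
  have orbits : jointOrbits σ τ = MulAction.orbitRel G α := by
    refine le_antisymm (jointOrbits_le_iff.2 ⟨fun x => ?_, fun x => ?_⟩) ?_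
    · exact Setoid.symm' _ ⟨⟨σ, Subgroup.subset_closure (by simp)⟩, rfl⟩
    · exact Setoid.symm' _ ⟨⟨τ, Subgroup.subset_closure (by simp)⟩, rfl⟩
    · suffices h : ∀ g ∈ G, ∀ x, jointOrbits σ τ (g x) x by
        rintro _ x ⟨g, rfl⟩
        exact h g.1 g.2 x
      intro g hg
      induction hg using Subgroup.closure_induction with
      | mem g hg =>
        obtain rfl | rfl := hg
        · exact fun x => Setoid.symm' _ (jointOrbits_left g τ x)
        · exact fun x => Setoid.symm' _ (jointOrbits_right σ g x)
      | one => exact Setoid.refl' _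
      | mul g g' _ _ hg hg' => exact fun x => Setoid.trans' _ (hg (g' x)) (hg' x)
      | inv g _ hg => exact fun x => by simpa using Setoid.symm' _ (hg (g⁻¹ x))
  rw [MulAction.pretransitive_iff_subsingleton_quotient, orbits]
  exact Quotient.subsingleton_iff

theorem factorSum_annularCycle (u v : ℕ → ℝ) (t s : ℕ) :
    factorSum u v (t + s) (annularCycle t s) = ∑ σ ∈ annularNC t s,
      prodOver u (cyclePartition σ) * prodOver v (cyclePartition (σ⁻¹ * annularCycle t s)) := by
  classical
  rw [factorSum, annularNC]
  simp only [cycleProd_eq_prodOver, isPretransitive_closure_pair_iff,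
    numCycles_eq_card_cyclePartition, jointOrbits_inv_mul]

theorem parts_partition_annularCycle {t s : ℕ} [NeZero t] [NeZero s] :
    (annularCycle t s).partition.parts = {t, s} := by
  rw [annularCycle, parts_partition_permCongr]
  refine (parts_partition_sumCongr _ _).trans ?_
  rw [parts_partition_finRotate, parts_partition_finRotate]
  rfl

theorem card_parts_partition_eq_mul {α : Type*} [Fintype α] [DecidableEq α]
    (c : Equiv.Perm α) :
    ({c' | c'.partition.parts = c.partition.parts} : Finset (Equiv.Perm α)).card *
      (c.partition.parts.prod *
        ∏ k ∈ c.partition.parts.toFinset, (c.partition.parts.count k).factorial) =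
      (Fintype.card α).factorial := by
  set m := c.cycleType
  set j := Fintype.card α - c.support.card
  have parts : c.partition.parts = m + Multiset.replicate j 1 := rfl
  have not_one_mem : 1 ∉ m := fun h => absurd (Equiv.Perm.two_le_of_mem_cycleType h) (by decide)
  have prod_factorial : ∏ k ∈ c.partition.parts.toFinset,
      (c.partition.parts.count k).factorial =
        j.factorial * ∏ k ∈ m.toFinset, (m.count k).factorial := by
    rw [Finset.prod_subset (s₂ := insert 1 m.toFinset) (fun k => ?_) fun k _ hk => ?_,
      Finset.prod_insert (by simpa)]
    · congr 1
      · simp [parts, not_one_mem]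
      · refine Finset.prod_congr rfl fun k hk => ?_
        have : 1 ≠ k := by rintro rfl; exact not_one_mem (by simpa using hk)
        simp [parts, Multiset.count_replicate, this]
    · simp only [parts, Multiset.mem_toFinset, Multiset.mem_add, Multiset.mem_replicate,
        Finset.mem_insert]
      tauto
    · rw [Multiset.count_eq_zero.2 (by simpa using hk), Nat.factorial_zero]
  have conj : {c' : Equiv.Perm α | IsConj c c'} =
      ({c' | c'.partition.parts = c.partition.parts} : Finset (Equiv.Perm α)) := by
    ext c'
    rw [Finset.coe_filter, Set.mem_ofPred_eq, Set.mem_ofPred_eq,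
      Equiv.Perm.partition_eq_of_isConj, Nat.Partition.ext_iff, eq_comm]
    simp
  rw [prod_factorial, ← Equiv.Perm.card_isConj_mul_eq c, conj, parts, Multiset.prod_add,
    Equiv.Perm.sum_cycleType, Multiset.prod_replicate, one_pow, mul_one]
  simp only [Nat.card_coe_set_eq, Set.ncard_coe_finset]
  ring

theorem card_parts_partition_eq_pair_mul {t s : ℕ} [NeZero t] [NeZero s] :
    ({c | c.partition.parts = {t, s}} : Finset (Equiv.Perm (Fin (t + s)))).card *
      (t * s * if t = s then 2 else 1) = (t + s).factorial := by
  have h := card_parts_partition_eq_mul (annularCycle t s)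
  rw [parts_partition_annularCycle] at h
  refine Eq.trans ?_ (h.trans (by rw [Fintype.card_fin]))
  congr 2
  · simp
  obtain rfl | hne := eq_or_ne t s
  · simp
  · simp [hne, hne.symm, Multiset.count_cons, Multiset.insert_eq_cons, Multiset.count_singleton]

theorem multiset_pair_eq_pair_iff {α : Type*} {a b c d : α} :
    ({a, b} : Multiset α) = {c, d} ↔ a = c ∧ b = d ∨ a = d ∧ b = c := by
  refine ⟨fun h => ?_, ?_⟩
  · simp only [Multiset.insert_eq_cons, Multiset.cons_eq_cons, Multiset.singleton_inj,
      Multiset.singleton_eq_cons_iff] at h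
    grind
  · rintro (⟨rfl, rfl⟩ | ⟨rfl, rfl⟩)
    exacts [rfl, Multiset.pair_comm _ _]

theorem sum_antidiagonal_pair_eq {n a b : ℕ} (h : a + b = n) (ha : 1 ≤ a) (hb : 1 ≤ b) :
    ∑ ts ∈ Finset.HasAntidiagonal.antidiagonal n with 1 ≤ ts.1 ∧ 1 ≤ ts.2,
      (if ({a, b} : Multiset ℕ) = {ts.1, ts.2} then if ts.1 = ts.2 then 2 else 1 else 0) = 2 := by
  rw [← Finset.sum_filter, Finset.filter_filter]
  have support : {ts ∈ Finset.HasAntidiagonal.antidiagonal n | (1 ≤ ts.1 ∧ 1 ≤ ts.2) ∧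
      ({a, b} : Multiset ℕ) = {ts.1, ts.2}} = {(a, b), (b, a)} := by
    ext ⟨t, s⟩
    simp only [Finset.mem_filter, Finset.HasAntidiagonal.mem_antidiagonal,
      multiset_pair_eq_pair_iff, Finset.mem_insert, Finset.mem_singleton, Prod.mk.injEq]
    lia
  rw [support]
  obtain rfl | hne := eq_or_ne a b
  · simp
  · rw [Finset.sum_pair (by simp [hne])]
    simp [hne, hne.symm]

theorem sum_numCycles_eq_two {K : Type*} [Field K] [CharZero K] {n : ℕ}
    (f : Equiv.Perm (Fin n) → K) (A : ℕ × ℕ → K)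
    (hA : ∀ t s c, c.partition.parts = {t, s} → f c = A (t, s)) :
    ∑ c with numCycles c = 2, f c = (n.factorial : K) / 2 *
      ∑ ts ∈ Finset.HasAntidiagonal.antidiagonal n with 1 ≤ ts.1 ∧ 1 ≤ ts.2,
        A ts / ((ts.1 : K) * ts.2) := by
  have double (c : Equiv.Perm (Fin n)) (hc : numCycles c = 2) :
      ∑ ts ∈ Finset.HasAntidiagonal.antidiagonal n with 1 ≤ ts.1 ∧ 1 ≤ ts.2,
        (if c.partition.parts = {ts.1, ts.2} then (if ts.1 = ts.2 then 2 else 1) * A ts else 0) =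
          2 * f c := by
    obtain ⟨a, b, hab⟩ := Multiset.card_eq_two.1 hc
    have sum_parts := c.partition.parts_sum
    rw [hab, Fintype.card_fin] at sum_parts
    have count := congrArg (Nat.cast : ℕ → K) (sum_antidiagonal_pair_eq (by simpa using sum_parts)
      (c.partition.parts_pos (by simp [hab])) (c.partition.parts_pos (by simp [hab])))
    rw [Nat.cast_sum, Nat.cast_ofNat] at count
    rw [hab]
    refine Eq.trans ?_ (congrArg (· * f c) count)
    rw [Finset.sum_mul]
    refine Finset.sum_congr rfl fun ts _ => ?_
    by_cases h : ({a, b} : Multiset ℕ) = {ts.1, ts.2}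
    · simp only [if_pos h, hA ts.1 ts.2 c (hab.trans h), Nat.cast_ite, Nat.cast_ofNat,
        Nat.cast_one]
    · simp only [if_neg h, Nat.cast_zero, zero_mul]
  refine mul_left_cancel₀ (two_ne_zero' K) ?_
  rw [Finset.mul_sum, ← Finset.sum_congr rfl fun c hc => double c (Finset.mem_filter.1 hc).2,
    Finset.sum_comm, ← mul_assoc, mul_div_cancel₀ _ two_ne_zero, Finset.mul_sum]
  refine Finset.sum_congr rfl ?_
  rintro ⟨t, s⟩ hts
  obtain ⟨hsum, ht, hs⟩ := Finset.mem_filter.1 hts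
  obtain rfl := Finset.HasAntidiagonal.mem_antidiagonal.1 hsum
  have : NeZero t := NeZero.of_pos ht
  have : NeZero s := NeZero.of_pos hs
  have two_cycles {c : Equiv.Perm (Fin (t + s))} (h : c.partition.parts = {t, s}) :
      numCycles c = 2 := by
    rw [numCycles, h, Multiset.card_pair]
  rw [← card_parts_partition_eq_pair_mul, ← Finset.sum_filter, Finset.filter_filter,
    Finset.filter_congr fun c _ => and_iff_right_of_imp two_cycles, Finset.sum_const, nsmul_eq_mul]
  have : (t : K) ≠ 0 := NeZero.natCast_ne t K
  have : (s : K) ≠ 0 := NeZero.natCast_ne s K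
  push_cast
  field_simp

theorem sum_transitivePairs_numCycles_eq (u v : ℕ → ℝ) {n : ℕ} [NeZero n] :
    ∑ q ∈ transitivePairs (Fin n) with numCycles q.1 + numCycles q.2 = n,
      cycleProd u q.1 * cycleProd v q.2 = (n - 1).factorial * annularSum u v n := by
  have two_cycles := sum_numCycles_eq_two (n := n) (factorSum u v n)
    (fun ts => factorSum u v (ts.1 + ts.2) (annularCycle ts.1 ts.2)) fun t s c hc => by
      have hn := c.partition.parts_sum
      rw [hc, Multiset.insert_eq_cons, Multiset.sum_cons, Multiset.sum_singleton,
        Fintype.card_fin] at hn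
      have : NeZero t := NeZero.of_pos (c.partition.parts_pos (by simp [hc]))
      have : NeZero s := NeZero.of_pos (c.partition.parts_pos (by simp [hc]))
      subst hn
      exact factorSum_congr u v _ (hc.trans parts_partition_annularCycle.symm)
  rw [sum_transitivePairs_eq_sum_factorSum, annularSum,
    ← Finset.sum_subset (Finset.subset_univ {c : Equiv.Perm (Fin n) | numCycles c = 2}),
    two_cycles]
  · simp only [factorSum_annularCycle, Finset.sum_div]
    rw [← Nat.mul_factorial_pred (NeZero.ne n)]
    push_cast
    ring
  · intro c _ hc
    by_contra h
    obtain ⟨genus, parity⟩ := le_and_even_of_factorSum_ne_zero h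
    have := numCycles_pos c
    simp only [Finset.mem_filter, Finset.mem_univ, true_and] at hc
    rw [Fintype.card_fin] at genus parity
    grind

/-! ### First-order expansions in `1/d` -/

/-- `f d = f₀ + f₁ / d + o(1/d)`, encoded as `d (f d - f₀) → f₁`. -/
def HasExpansion (f : ℕ → ℝ) (f₀ f₁ : ℝ) : Prop :=
  Tendsto (fun d : ℕ => (d : ℝ) * (f d - f₀)) atTop (𝓝 f₁)

namespace HasExpansion

variable {f g : ℕ → ℝ} {f₀ f₁ g₀ g₁ : ℝ}

theorem congr' (h : HasExpansion f f₀ f₁) (hfg : f =ᶠ[atTop] g) : HasExpansion g f₀ f₁ :=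
  Tendsto.congr' (hfg.mono fun d hd => by rw [hd]) h

theorem tendsto (h : HasExpansion f f₀ f₁) : Tendsto f atTop (𝓝 f₀) := by
  have difference := (tendsto_inv_atTop_nhds_zero_nat (𝕜 := ℝ)).mul h
  rw [zero_mul] at difference
  refine tendsto_sub_nhds_zero_iff.1 (difference.congr' ?_)
  filter_upwards [eventually_ne_atTop 0] with d hd
  exact inv_mul_cancel_left₀ (Nat.cast_ne_zero.2 hd) _

theorem const (c : ℝ) : HasExpansion (fun _ => c) c 0 := by
  simp [HasExpansion]

theorem add (hf : HasExpansion f f₀ f₁) (hg : HasExpansion g g₀ g₁) :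
    HasExpansion (fun d => f d + g d) (f₀ + g₀) (f₁ + g₁) :=
  (Tendsto.add hf hg).congr fun d => by ring

theorem sub (hf : HasExpansion f f₀ f₁) (hg : HasExpansion g g₀ g₁) :
    HasExpansion (fun d => f d - g d) (f₀ - g₀) (f₁ - g₁) :=
  (Tendsto.sub hf hg).congr fun d => by ring

theorem mul (hf : HasExpansion f f₀ f₁) (hg : HasExpansion g g₀ g₁) :
    HasExpansion (fun d => f d * g d) (f₀ * g₀) (f₁ * g₀ + f₀ * g₁) :=
  ((Tendsto.mul hf hg.tendsto).add (Tendsto.const_mul f₀ hg)).congr fun d => by ring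

theorem mul_tendsto (hf : HasExpansion f 0 f₁) (hg : Tendsto g atTop (𝓝 g₀)) :
    HasExpansion (fun d => f d * g d) 0 (f₁ * g₀) :=
  (Tendsto.mul hf hg).congr fun d => by ring

theorem div (hf : HasExpansion f f₀ f₁) (hg : HasExpansion g g₀ g₁) (h0 : g₀ ≠ 0) :
    HasExpansion (fun d => f d / g d) (f₀ / g₀) ((f₁ * g₀ - f₀ * g₁) / (g₀ * g₀)) := by
  refine ((Tendsto.sub (Tendsto.mul_const g₀ hf) (Tendsto.const_mul f₀ hg)).div
    (hg.tendsto.mul_const g₀) (mul_ne_zero h0 h0)).congr' ?_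
  filter_upwards [hg.tendsto.eventually_ne h0] with d hd
  rw [Pi.div_apply]
  field_simp
  ring

theorem sum {ι : Type*} {s : Finset ι} {F : ι → ℕ → ℝ} {F₀ F₁ : ι → ℝ}
    (h : ∀ i ∈ s, HasExpansion (F i) (F₀ i) (F₁ i)) :
    HasExpansion (fun d => ∑ i ∈ s, F i d) (∑ i ∈ s, F₀ i) (∑ i ∈ s, F₁ i) :=
  (tendsto_finsetSum s h).congr fun d => by rw [← Finset.sum_sub_distrib, Finset.mul_sum]

theorem prod {ι : Type*} [DecidableEq ι] {s : Finset ι} {F : ι → ℕ → ℝ} {F₀ F₁ : ι → ℝ}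
    (h : ∀ i ∈ s, HasExpansion (F i) (F₀ i) (F₁ i)) :
    HasExpansion (fun d => ∏ i ∈ s, F i d) (∏ i ∈ s, F₀ i)
      (∑ i ∈ s, F₁ i * ∏ j ∈ s.erase i, F₀ j) := by
  induction s using Finset.induction with
  | empty => simpa using const 1
  | insert a s ha ih =>
    have step := (h a (Finset.mem_insert_self a s)).mul
      (ih fun i hi => h i (Finset.mem_insert_of_mem hi))
    simp only [Finset.prod_insert ha, Finset.sum_insert ha, Finset.erase_insert ha]
    convert step using 2
    rw [Finset.mul_sum]
    refine Finset.sum_congr rfl fun i hi => ?_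
    rw [Finset.erase_insert_of_ne (ne_of_mem_of_not_mem hi ha).symm,
      Finset.prod_insert fun h => ha (Finset.mem_of_mem_erase h), mul_left_comm]

theorem neg_one_div : HasExpansion (fun d => -1 / (d : ℝ)) 0 (-1) := by
  refine tendsto_const_nhds.congr' ?_
  filter_upwards [eventually_ne_atTop 0] with d hd
  rw [sub_zero, mul_div_cancel₀ _ (Nat.cast_ne_zero.2 hd)]

theorem neg_one_div_pow (k : ℕ) : HasExpansion (fun d => (-1 / (d : ℝ)) ^ k)
    (if k = 0 then 1 else 0) (if k = 1 then -1 else 0) := by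
  induction k with
  | zero => simpa using const 1
  | succ k ih =>
    have step := ih.mul neg_one_div
    simp only [pow_succ]
    convert step using 1
    · simp
    · by_cases hk : k = 0 <;> simp [hk]

theorem isLittleO_iff :
    (fun d : ℕ => f d - (f₀ + f₁ / (d : ℝ))) =o[atTop] (fun d : ℕ => 1 / (d : ℝ)) ↔
      HasExpansion f f₀ f₁ := by
  rw [Asymptotics.isLittleO_iff_tendsto', HasExpansion, ← tendsto_sub_nhds_zero_iff (x := f₁)]
  · refine tendsto_congr' ?_
    filter_upwards [eventually_ne_atTop 0] with d hd
    field_simp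
    ring
  · filter_upwards [eventually_ne_atTop 0] with d hd h
    simp [hd] at h

theorem prodOver {n : ℕ} {x : ℕ → ℕ → ℝ} {u u' : ℕ → ℝ} {π : SetPartition n}
    (h : ∀ V ∈ π.parts, HasExpansion (fun d => x d V.card) (u V.card) (u' V.card)) :
    HasExpansion (fun d => prodOver (x d) π) (prodOver u π) (derivOver u u' π) :=
  HasExpansion.prod h

end HasExpansion

theorem tendsto_annularSum {x y : ℕ → ℕ → ℝ} {u v : ℕ → ℝ}
    (hx : ∀ k, 1 ≤ k → Tendsto (fun d => x d k) atTop (𝓝 (u k)))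
    (hy : ∀ k, 1 ≤ k → Tendsto (fun d => y d k) atTop (𝓝 (v k))) (n : ℕ) :
    Tendsto (fun d => annularSum (x d) (y d) n) atTop (𝓝 (annularSum u v n)) := by
  have product {x : ℕ → ℕ → ℝ} {u : ℕ → ℝ}
      (hx : ∀ k, 1 ≤ k → Tendsto (fun d => x d k) atTop (𝓝 (u k))) {m : ℕ} (π : SetPartition m) :
      Tendsto (fun d => prodOver (x d) π) atTop (𝓝 (prodOver u π)) :=
    tendsto_finsetProd _ fun V hV => hx _ (π.nonempty_of_mem_parts hV).card_pos
  exact Tendsto.const_mul _ <| tendsto_finsetSum _ fun _ _ => tendsto_finsetSum _ fun _ _ =>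
    ((product hx _).mul (product hy _)).div_const _

/-! ### The first-order expansion of the cumulants of a product -/

section GenusExpansion

variable {n : ℕ} [NeZero n]

theorem seqCumulant_mul_eq_genus_expansion {d : ℝ} (hd : d ≠ 0) {a b : ℕ → ℝ} (ha : a 0 = 1)
    (hb : b 0 = 1) :
    seqCumulant d (fun k => a k * b k) n =
      ∑ π ∈ NC n, prodOver (seqCumulant d a) π * prodOver (seqCumulant d b) (kreweras π) +
      -1 / d * annularSum (seqCumulant d a) (seqCumulant d b) n +
      1 / (n - 1).factorial *
        ∑ q ∈ transitivePairs (Fin n) with numCycles q.1 + numCycles q.2 < n,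
          (-1 / d) ^ (n + 1 - numCycles q.1 - numCycles q.2) *
            (cycleProd (seqCumulant d a) q.1 * cycleProd (seqCumulant d b) q.2) := by
  have cycles_le (q) (hq : q ∈ transitivePairs (Fin n)) :
      numCycles q.1 + numCycles q.2 ≤ n + 1 := by
    have genus := numCycles_add_le_of_transitive (mem_transitivePairs.1 hq)
    have := numCycles_pos (q.1 * q.2)
    rw [Fintype.card_fin] at genus
    lia
  rw [seqCumulant_mul hd ha hb NeZero.one_le]
  set f := fun q : Equiv.Perm (Fin n) × Equiv.Perm (Fin n) =>
    cycleProd (seqCumulant d a) q.1 * cycleProd (seqCumulant d b) q.2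
  have split : ∑ q ∈ transitivePairs (Fin n),
      (-1 / d) ^ (n + 1 - numCycles q.1 - numCycles q.2) * f q =
      ∑ q ∈ transitivePairs (Fin n) with numCycles q.1 + numCycles q.2 = n + 1, f q +
      -1 / d * ∑ q ∈ transitivePairs (Fin n) with numCycles q.1 + numCycles q.2 = n, f q +
      ∑ q ∈ transitivePairs (Fin n) with numCycles q.1 + numCycles q.2 < n,
        (-1 / d) ^ (n + 1 - numCycles q.1 - numCycles q.2) * f q := by
    simp only [Finset.mul_sum, Finset.sum_filter, ← Finset.sum_add_distrib]
    refine Finset.sum_congr rfl fun q hq => ?_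
    obtain h | h | h : numCycles q.1 + numCycles q.2 = n + 1 ∨ numCycles q.1 + numCycles q.2 = n ∨
        numCycles q.1 + numCycles q.2 < n := by have := cycles_le q hq; lia
    · simp [h, Nat.sub_sub]
    · simp [h, Nat.sub_sub]
    · simp [h, h.ne, (h.trans n.lt_succ_self).ne]
  have factorial_ne_zero : ((n - 1).factorial : ℝ) ≠ 0 :=
    Nat.cast_ne_zero.2 (Nat.factorial_ne_zero _)
  rw [split, sum_transitivePairs_numCycles_eq_succ, sum_transitivePairs_numCycles_eq, mul_add,
    mul_add, mul_left_comm _ (-1 / d), one_div, inv_mul_cancel_left₀ factorial_ne_zero,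
    inv_mul_cancel_left₀ factorial_ne_zero]

end GenusExpansion

theorem hasExpansion_seqCumulant_mul {a b : ℕ → ℕ → ℝ} (ha : ∀ᶠ d in atTop, a d 0 = 1)
    (hb : ∀ᶠ d in atTop, b d 0 = 1) {u u' v v' : ℕ → ℝ}
    (hu : ∀ k, 1 ≤ k → HasExpansion (fun d => seqCumulant d (a d) k) (u k) (u' k))
    (hv : ∀ k, 1 ≤ k → HasExpansion (fun d => seqCumulant d (b d) k) (v k) (v' k))
    {n : ℕ} (hn : 1 ≤ n) :
    HasExpansion (fun d => seqCumulant d (fun k => a d k * b d k) n)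
      (∑ π ∈ NC n, prodOver u π * prodOver v (kreweras π)) (mulFluctuation u u' v v' n) := by
  have : NeZero n := NeZero.of_pos hn
  have expand_u (π : SetPartition n) := HasExpansion.prodOver (π := π) fun V hV =>
    hu _ (π.nonempty_of_mem_parts hV).card_pos
  have expand_v (π : SetPartition n) := HasExpansion.prodOver (π := π) fun V hV =>
    hv _ (π.nonempty_of_mem_parts hV).card_pos
  have planar := HasExpansion.sum (s := NC n) fun π _ => (expand_u π).mul (expand_v (kreweras π))
  have annular := HasExpansion.neg_one_div.mul_tendsto
    (tendsto_annularSum (fun k hk => (hu k hk).tendsto) (fun k hk => (hv k hk).tendsto) n)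
  have higher (q) (hq : q ∈ {q ∈ transitivePairs (Fin n) | numCycles q.1 + numCycles q.2 < n}) :
      HasExpansion (fun d => (-1 / (d : ℝ)) ^ (n + 1 - numCycles q.1 - numCycles q.2) *
        (cycleProd (seqCumulant (d : ℝ) (a d)) q.1 *
          cycleProd (seqCumulant (d : ℝ) (b d)) q.2)) 0 0 := by
    have power := HasExpansion.neg_one_div_pow (n + 1 - numCycles q.1 - numCycles q.2)
    have := (Finset.mem_filter.1 hq).2
    rw [if_neg (by lia), if_neg (by lia)] at power
    simp only [cycleProd_eq_prodOver]
    simpa only [zero_mul] using power.mul_tendsto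
      ((expand_u (cyclePartition q.1)).mul (expand_v (cyclePartition q.2))).tendsto
  have total := (planar.add annular).add
    ((HasExpansion.const (1 / (n - 1).factorial)).mul (HasExpansion.sum higher))
  simp only [Finset.sum_const_zero, mul_zero, add_zero, neg_one_mul, ← sub_eq_add_neg] at total
  refine total.congr' ?_
  filter_upwards [ha, hb, eventually_ne_atTop 0] with d ha hb hd
  exact (seqCumulant_mul_eq_genus_expansion (Nat.cast_ne_zero.2 hd) ha hb).symm

theorem seqCumulant_mul_of_seqCumulant_eq_one {K : Type*} [Field K] [CharZero K] {d : K}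
    (hd : d ≠ 0) {a b : ℕ → K} (ha : a 0 = 1) (hb : b 0 = 1)
    (hb1 : ∀ k, 1 ≤ k → seqCumulant d b k = 1) {n : ℕ} [NeZero n] :
    seqCumulant d (fun k => a k * b k) n =
      seqCumulant d a n * ∑ τ : Equiv.Perm (Fin n), (-1 / d) ^ (n - numCycles τ) +
      1 / (n - 1).factorial * ∑ q ∈ transitivePairs (Fin n) with ¬numCycles q.1 = 1,
        (-1 / d) ^ (n + 1 - numCycles q.1 - numCycles q.2) * cycleProd (seqCumulant d a) q.1 := by
  classical
  have product_one (σ : Equiv.Perm (Fin n)) : cycleProd (seqCumulant d b) σ = 1 := by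
    rw [cycleProd]
    refine Multiset.prod_eq_one fun x hx => ?_
    obtain ⟨k, hk, rfl⟩ := Multiset.mem_map.1 hx
    exact hb1 k (σ.partition.parts_pos hk)
  have one_cycle : {q ∈ transitivePairs (Fin n) | numCycles q.1 = 1} =
      ({σ | Equiv.Perm.SameCycle.setoid σ = ⊤} : Finset (Equiv.Perm (Fin n))) ×ˢ Finset.univ := by
    ext q
    simp only [Finset.mem_filter, mem_transitivePairs, numCycles_eq_one_iff, Finset.mem_product,
      Finset.mem_univ, true_and, and_true, and_iff_right_iff_imp]
    intro h
    rw [jointOrbits, h, top_sup_eq]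
  have top_term : ∑ q ∈ transitivePairs (Fin n) with numCycles q.1 = 1,
      (-1 / d) ^ (n + 1 - numCycles q.1 - numCycles q.2) * cycleProd (seqCumulant d a) q.1 =
      (n - 1).factorial *
        (seqCumulant d a n * ∑ τ : Equiv.Perm (Fin n), (-1 / d) ^ (n - numCycles τ)) := by
    rw [one_cycle, Finset.sum_product, ← card_setoid_sameCycle_eq_top NeZero.one_le,
      ← nsmul_eq_mul]
    refine Finset.sum_eq_card_nsmul fun σ hσ => ?_
    have one_orbit := (Finset.mem_filter.1 hσ).2
    simp [numCycles_eq_one_iff.2 one_orbit, cycleProd,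
      parts_partition_of_setoid_eq_top one_orbit, Finset.mul_sum, mul_comm]
  rw [seqCumulant_mul hd ha hb NeZero.one_le]
  simp only [product_one, mul_one]
  rw [← Finset.sum_filter_add_sum_filter_not _ fun q => numCycles q.1 = 1, top_term, mul_add,
    one_div, inv_mul_cancel_left₀ (Nat.cast_ne_zero.2 (Nat.factorial_ne_zero _))]

theorem card_lt_of_numCycles_ne_one {n : ℕ} [NeZero n] {σ : Equiv.Perm (Fin n)}
    (hσ : numCycles σ ≠ 1) {V : Finset (Fin n)} (hV : V ∈ (cyclePartition σ).parts) :
    V.card < n := by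
  refine card_lt_of_ne NeZero.one_le _ (fun indiscrete => hσ ?_) V hV
  rw [numCycles_eq_card_cyclePartition, indiscrete, Finpartition.indiscrete_parts,
    Finset.card_singleton]

theorem HasExpansion.exists_sum_perm (n : ℕ) : ∃ c₀ c₁, c₀ ≠ 0 ∧
    HasExpansion (fun d => ∑ τ : Equiv.Perm (Fin n), (-1 / (d : ℝ)) ^ (n - numCycles τ)) c₀ c₁ := by
  refine ⟨_, _, ?_, HasExpansion.sum fun τ _ => HasExpansion.neg_one_div_pow (n - numCycles τ)⟩
  refine (Finset.sum_pos' (fun τ _ => by positivity) ⟨1, Finset.mem_univ _, ?_⟩).ne'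
  simp [numCycles_one]

/-- The product formula expresses the cumulants of `a b` through those of `a` by a triangular
system, which is solved here recursively for the latter. -/
theorem exists_hasExpansion_seqCumulant_of_mul {a b : ℕ → ℕ → ℝ} (ha : ∀ᶠ d in atTop, a d 0 = 1)
    (hb : ∀ᶠ d in atTop, b d 0 = 1)
    (hb1 : ∀ᶠ d : ℕ in atTop, ∀ k, 1 ≤ k → seqCumulant (d : ℝ) (b d) k = 1) {z z' : ℕ → ℝ}
    (hz : ∀ k, 1 ≤ k →
      HasExpansion (fun d => seqCumulant d (fun k => a d k * b d k) k) (z k) (z' k))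
    (n : ℕ) (hn : 1 ≤ n) : ∃ u u', HasExpansion (fun d => seqCumulant d (a d) n) u u' := by
  induction n using Nat.strong_induction_on with
  | _ n ih =>
    have : NeZero n := NeZero.of_pos hn
    choose! u u' hu using ih
    obtain ⟨c₀, c₁, c₀_ne_zero, unit⟩ := HasExpansion.exists_sum_perm n
    have lower (q) (hq : q ∈ {q ∈ transitivePairs (Fin n) | ¬numCycles q.1 = 1}) :=
      (HasExpansion.neg_one_div_pow (n + 1 - numCycles q.1 - numCycles q.2)).mul <|
        HasExpansion.prodOver (x := fun d => seqCumulant (d : ℝ) (a d)) fun V hV =>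
          hu _ (card_lt_of_numCycles_ne_one (Finset.mem_filter.1 hq).2 hV)
            ((cyclePartition q.1).nonempty_of_mem_parts hV).card_pos
    refine ⟨_, _, (((hz n hn).sub ((HasExpansion.const (1 / (n - 1).factorial)).mul
      (HasExpansion.sum lower))).div unit c₀_ne_zero).congr' ?_⟩
    filter_upwards [ha, hb, hb1, unit.tendsto.eventually_ne c₀_ne_zero, eventually_ne_atTop 0]
      with d ha hb hb1 hunit hd
    rw [seqCumulant_mul_of_seqCumulant_eq_one (Nat.cast_ne_zero.2 hd) ha hb hb1,
      div_eq_iff hunit, sub_eq_iff_eq_add]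
    simp only [cycleProd_eq_prodOver]

/-! ### Moments as cumulants -/

theorem mul_esymm_eq_sum_map_pow {R : Type*} [CommRing R] (s : Multiset R) (k : ℕ) :
    k * s.esymm k = (-1) ^ (k + 1) *
      ∑ a ∈ Finset.HasAntidiagonal.antidiagonal k with a.1 < k,
        (-1) ^ a.1 * s.esymm a.1 * (s.map (· ^ a.2)).sum := by
  rw [← Multiset.coe_toList s]
  generalize s.toList = l
  have values : Finset.univ.val.map l.get = (l : Multiset R) := by
    rw [Fin.univ_val_map, List.ofFn_get]
  have aeval_psum (k : ℕ) : MvPolynomial.aeval l.get (MvPolynomial.psum (Fin l.length) R k) =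
      ((l : Multiset R).map (· ^ k)).sum := by
    rw [← values, Multiset.map_map, MvPolynomial.psum, map_sum]
    simp only [map_pow, MvPolynomial.aeval_X]
    rfl
  simpa only [map_mul, map_sum, map_pow, map_neg, map_one, map_natCast, aeval_psum,
    MvPolynomial.aeval_esymm_eq_multiset_esymm, values] using
    congrArg (MvPolynomial.aeval l.get) (MvPolynomial.mul_esymm_eq_sum (Fin l.length) R k)

theorem isExpSeq_factorial_mul_esymm {R : Type*} [CommRing R] (s : Multiset R) :
    IsExpSeq (fun k => k.factorial * s.esymm k)
      (fun k => (-1) ^ (k - 1) * (k - 1).factorial * (s.map (· ^ k)).sum) := by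
  intro n
  have newton := mul_esymm_eq_sum_map_pow s (n + 1)
  rw [Finset.sum_filter, Finset.Nat.sum_antidiagonal_eq_sum_range_succ_mk, Finset.sum_range_succ,
    if_neg (lt_irrefl _), add_zero, ← Finset.sum_range_reflect, Finset.mul_sum] at newton
  beta_reduce
  rw [Nat.factorial_succ, mul_comm (n + 1), Nat.cast_mul, mul_assoc, newton, Finset.mul_sum]
  refine Finset.sum_congr rfl fun k hk => ?_
  obtain ⟨j, rfl⟩ := Nat.exists_eq_add_of_le (Nat.lt_succ_iff.1 (Finset.mem_range.1 hk))
  have sign : (-1 : R) ^ (k + j + 1 + 1) * (-1) ^ j = (-1) ^ k := by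
    rw [← pow_add]
    exact neg_one_pow_congr (by grind)
  have factorials : ((k + j).factorial : R) = (k + j).choose k * k.factorial * j.factorial := by
    rw [← Nat.add_choose_mul_factorial_mul_factorial, Nat.choose_symm_add, Nat.cast_mul,
      Nat.cast_mul]
  rw [show k + j + 1 - 1 - k = j by lia, if_pos (by lia), show k + j + 1 - j = k + 1 by lia,
    Nat.add_sub_cancel_left, Nat.add_sub_cancel, factorials, ← sign]
  ring

theorem IsExpSeq.mul_geom {R : Type*} [CommSemiring R] {a c : ℕ → R} (h : IsExpSeq a c) (r : R) :
    IsExpSeq (fun n => a n * r ^ n) (fun n => c n * r ^ n) := by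
  intro n
  beta_reduce
  rw [h n, Finset.sum_mul]
  refine Finset.sum_congr rfl fun k hk => ?_
  obtain ⟨j, rfl⟩ := Nat.exists_eq_add_of_le (Nat.lt_succ_iff.1 (Finset.mem_range.1 hk))
  rw [Nat.add_sub_cancel_left]
  ring

theorem IsExpSeq.of_map {R S : Type*} [CommSemiring R] [CommSemiring S] {f : R →+* S}
    (hf : Function.Injective f) {a c : ℕ → R} (h : IsExpSeq (fun n => f (a n)) fun n => f (c n)) :
    IsExpSeq a c := fun n => hf (by simpa using h n)

/-- The coefficients `d (d - 1) ⋯ (d - k + 1) / d ^ k` of a rescaled Laguerre polynomial. All its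
cumulants are `1`, and multiplication by it turns moments of roots into cumulants. -/
noncomputable def laguerreSeq (d k : ℕ) : ℝ := d.descFactorial k / (d : ℝ) ^ k

theorem laguerreSeq_zero (d : ℕ) : laguerreSeq d 0 = 1 := by simp [laguerreSeq]

theorem normCoeff_of_lt {d k : ℕ} (h : d < k) (p : ℝ[X]) : normCoeff d p k = 0 := by
  simp [normCoeff, Nat.choose_eq_zero_of_lt h]

theorem normCoeff_zero {d : ℕ} {p : ℝ[X]} (hp : IsMonicOfDegree p d) : normCoeff d p 0 = 1 := by
  simp [normCoeff, ((isMonicOfDegree_iff p d).1 hp).2]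

theorem card_aroots {d : ℕ} {p : ℝ[X]} (hp : IsMonicOfDegree p d) : (p.aroots ℂ).card = d := by
  rw [aroots, IsAlgClosed.card_roots_eq_natDegree, hp.monic.natDegree_map, hp.natDegree_eq]

theorem normCoeff_mul_laguerreSeq {d : ℕ} {p : ℝ[X]} (hp : IsMonicOfDegree p d) (k : ℕ) :
    ((normCoeff d p k * laguerreSeq d k : ℝ) : ℂ) =
      k.factorial * (p.aroots ℂ).esymm k * (1 / (d : ℂ)) ^ k := by
  rcases Nat.lt_or_ge d k with h | h
  · rw [normCoeff_of_lt h, Multiset.esymm,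
      Multiset.powersetCard_eq_empty k (by rwa [card_aroots hp])]
    simp
  · have natDegree_map : (p.map (algebraMap ℝ ℂ)).natDegree = d := by
      rw [hp.monic.natDegree_map, hp.natDegree_eq]
    have vieta := Polynomial.coeff_eq_esymm_roots_of_card (p := p.map (algebraMap ℝ ℂ))
      (by rw [natDegree_map]; exact card_aroots hp) (k := d - k) (by rw [natDegree_map]; lia)
    rw [natDegree_map, (hp.monic.map _).leadingCoeff, one_mul, Nat.sub_sub_self h, coeff_map,
      Complex.coe_algebraMap] at vieta
    have choose_ne_zero : (d.choose k : ℂ) ≠ 0 := Nat.cast_ne_zero.2 (Nat.choose_pos h).ne'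
    have sign : (-1 : ℂ) ^ k * (-1) ^ k = 1 := by rw [← mul_pow]; simp
    rw [normCoeff, laguerreSeq, Nat.descFactorial_eq_factorial_mul_choose]
    push_cast
    rw [vieta, ← mul_assoc, sign, aroots, one_div_pow]
    field_simp

theorem rootMoment_eq_seqCumulant {d : ℕ} (hd : d ≠ 0) {p : ℝ[X]} (hp : IsMonicOfDegree p d)
    {n : ℕ} (hn : 1 ≤ n) :
    rootMoment d p n = seqCumulant (d : ℝ) (fun k => normCoeff d p k * laguerreSeq d k) n := by
  let powerSum (k : ℕ) : ℝ := ((p.aroots ℂ).map (· ^ k)).sum.re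
  have powerSum_ofReal (k : ℕ) : (powerSum k : ℂ) = ((p.aroots ℂ).map (· ^ k)).sum :=
    Complex.ext (by simp [powerSum]) (by rw [Complex.ofReal_im, rootPowerSum_im])
  have newton : IsExpSeq (fun k => normCoeff d p k * laguerreSeq d k)
      (fun k => (-1) ^ (k - 1) * (k - 1).factorial * powerSum k * (1 / d) ^ k) := by
    apply IsExpSeq.of_map (f := Complex.ofRealHom) Complex.ofReal_injective
    simpa [normCoeff_mul_laguerreSeq hp, powerSum_ofReal] using
      (isExpSeq_factorial_mul_esymm (p.aroots ℂ)).mul_geom (1 / (d : ℂ))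
  obtain ⟨m, rfl⟩ := Nat.exists_eq_add_of_le' hn
  have sign : (-(d : ℝ)) ^ m * (-1) ^ m = d ^ m := by rw [← mul_pow, neg_mul_neg, mul_one]
  have factorial_ne_zero : (m.factorial : ℝ) ≠ 0 := Nat.cast_ne_zero.2 m.factorial_ne_zero
  rw [newton.seqCumulant_eq (by rw [normCoeff_zero hp, laguerreSeq_zero, one_mul]) _ hn]
  change powerSum (m + 1) / d = _
  rw [Nat.add_sub_cancel]
  calc powerSum (m + 1) / d = d ^ m * (powerSum (m + 1) * (1 / d) ^ (m + 1)) := by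
        rw [one_div_pow, pow_succ]
        field_simp
    _ = _ := by
        rw [← sign]
        field_simp

theorem rootMoment_zero {d : ℕ} (hd : d ≠ 0) {p : ℝ[X]} (hp : IsMonicOfDegree p d) :
    rootMoment d p 0 = 1 := by
  simp [rootMoment, card_aroots hp, hd]

theorem normCoeff_X_sub_one_pow {d k : ℕ} (h : k ≤ d) : normCoeff d ((X - C 1) ^ d) k = 1 := by
  have choose_ne_zero : (d.choose k : ℝ) ≠ 0 := Nat.cast_ne_zero.2 (Nat.choose_pos h).ne'
  rw [normCoeff, sub_eq_add_neg, ← C_neg, coeff_X_add_C_pow, Nat.sub_sub_self h,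
    Nat.choose_symm h, ← mul_assoc, ← mul_pow, div_eq_one_iff_eq choose_ne_zero]
  simp

theorem seqCumulant_laguerreSeq {d : ℕ} (hd : d ≠ 0) {n : ℕ} (hn : 1 ≤ n) :
    seqCumulant (d : ℝ) (laguerreSeq d) n = 1 := by
  have laguerreSeq_eq : laguerreSeq d =
      fun k => normCoeff d ((X - C 1) ^ d) k * laguerreSeq d k := by
    ext k
    rcases Nat.lt_or_ge d k with h | h
    · simp [laguerreSeq, Nat.descFactorial_of_lt h]
    · rw [normCoeff_X_sub_one_pow h, one_mul]
  have monic : IsMonicOfDegree ((X - C 1 : ℝ[X]) ^ d) d := by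
    simpa using (isMonicOfDegree_X_sub_one (1 : ℝ)).pow d
  rw [laguerreSeq_eq, ← rootMoment_eq_seqCumulant hd monic hn,
    rootMoment_of_splits d ((Splits.X_sub_C 1).pow d), roots_pow, roots_X_sub_C]
  simp [Multiset.nsmul_singleton, hd]

/-! ### The multiplicative convolution -/

theorem coeff_mulConv (d : ℕ) (p q : ℝ[X]) {k : ℕ} (hk : k ≤ d) :
    (mulConv d p q).coeff (d - k) =
      (-1) ^ k * d.choose k * (normCoeff d p k * normCoeff d q k) := by
  rw [mulConv, finsetSum_coeff, Finset.sum_eq_single_of_mem k (Finset.mem_range.2 (by lia))]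
  · rw [coeff_C_mul, coeff_X_pow_self, mul_one]
  · intro j hj hjk
    rw [coeff_C_mul, coeff_X_pow, if_neg (by have := Finset.mem_range.1 hj; lia), mul_zero]

theorem normCoeff_mulConv (d : ℕ) (p q : ℝ[X]) :
    normCoeff d (mulConv d p q) = fun k => normCoeff d p k * normCoeff d q k := by
  ext k
  rcases Nat.lt_or_ge d k with h | h
  · simp only [normCoeff_of_lt h, zero_mul]
  · have choose_ne_zero : (d.choose k : ℝ) ≠ 0 := Nat.cast_ne_zero.2 (Nat.choose_pos h).ne'
    rw [normCoeff, coeff_mulConv d p q h, div_eq_iff choose_ne_zero, mul_assoc, ← mul_assoc,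
      ← mul_pow, neg_one_mul, neg_neg, one_pow, one_mul, mul_comm]

theorem isMonicOfDegree_mulConv {d : ℕ} {p q : ℝ[X]} (hp : IsMonicOfDegree p d)
    (hq : IsMonicOfDegree q d) : IsMonicOfDegree (mulConv d p q) d := by
  refine (isMonicOfDegree_iff _ d).2 ⟨natDegree_sum_le_of_forall_le _ _ fun k _ =>
    (natDegree_C_mul_X_pow_le _ _).trans (Nat.sub_le d k), ?_⟩
  simpa [normCoeff_zero hp, normCoeff_zero hq] using coeff_mulConv d p q (Nat.zero_le d)

/-! ### The expansions of a product -/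

theorem prodOver_congr {u v : ℕ → ℝ} (h : ∀ k, 1 ≤ k → u k = v k) {n : ℕ} (π : SetPartition n) :
    prodOver u π = prodOver v π :=
  Finset.prod_congr rfl fun _ hV => h _ (Finset.card_pos.2 (π.nonempty_of_mem_parts hV))

theorem prodOver_one {n : ℕ} (π : SetPartition n) : prodOver (fun _ => 1) π = 1 :=
  Finset.prod_const_one

theorem eq_of_freeCumulant_eq {m k : ℕ → ℝ} (h : ∀ n, 1 ≤ n → freeCumulant m n = freeCumulant k n)
    {n : ℕ} (hn : 1 ≤ n) : m n = k n := by
  rw [moment_eq_sum_freeCumulant m hn, moment_eq_sum_freeCumulant k hn]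
  exact Finset.sum_congr rfl fun π _ => prodOver_congr h π

theorem mulFluctuation_one (u u' : ℕ → ℝ) (n : ℕ) :
    mulFluctuation u u' (fun _ => 1) (fun _ => 0) n = infinitesimalMoment u u' n := by
  simp [mulFluctuation, infinitesimalMoment, prodOver_one, derivOver]

theorem hasExpansion_rootMoment {p : ℕ → ℝ[X]} (hp : ∀ᶠ d in atTop, IsMonicOfDegree (p d) d)
    {u u' : ℕ → ℝ} (hu : ∀ k, 1 ≤ k → HasExpansion (fun d => finiteCumulant d (p d) k) (u k) (u' k))
    {n : ℕ} (hn : 1 ≤ n) :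
    HasExpansion (fun d => rootMoment d (p d) n) (∑ π ∈ NC n, prodOver u π)
      (infinitesimalMoment u u' n) := by
  have laguerre (k : ℕ) (hk : 1 ≤ k) :
      HasExpansion (fun d => seqCumulant (d : ℝ) (laguerreSeq d) k) 1 0 :=
    (HasExpansion.const 1).congr' <| by
      filter_upwards [eventually_ne_atTop 0] with d hd using (seqCumulant_laguerreSeq hd hk).symm
  have product := hasExpansion_seqCumulant_mul (hp.mono fun d => normCoeff_zero)
    (Eventually.of_forall laguerreSeq_zero) hu laguerre hn
  simp only [mulFluctuation_one, prodOver_one, mul_one] at product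
  refine product.congr' ?_
  filter_upwards [hp, eventually_ne_atTop 0] with d monic hd
  exact (rootMoment_eq_seqCumulant hd monic hn).symm

theorem exists_hasExpansion_finiteCumulant {p : ℕ → ℝ[X]}
    (hp : ∀ᶠ d in atTop, IsMonicOfDegree (p d) d) {m m' : ℕ → ℝ}
    (hm : ∀ n, 1 ≤ n → HasExpansion (fun d => rootMoment d (p d) n) (m n) (m' n)) :
    ∃ r : ℕ → ℝ, ∀ n, 1 ≤ n →
      HasExpansion (fun d => finiteCumulant d (p d) n) (freeCumulant m n) (r n) := by
  have product (n : ℕ) (hn : 1 ≤ n) : HasExpansion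
      (fun d => seqCumulant (d : ℝ) (fun k => normCoeff d (p d) k * laguerreSeq d k) n)
      (m n) (m' n) := (hm n hn).congr' <| by
    filter_upwards [hp, eventually_ne_atTop 0] with d monic hd
    exact rootMoment_eq_seqCumulant hd monic hn
  have laguerre : ∀ᶠ d : ℕ in atTop, ∀ k, 1 ≤ k → seqCumulant (d : ℝ) (laguerreSeq d) k = 1 := by
    filter_upwards [eventually_ne_atTop 0] with d hd k hk using seqCumulant_laguerreSeq hd hk
  choose! u u' hu using exists_hasExpansion_seqCumulant_of_mul
    (hp.mono fun d => normCoeff_zero) (Eventually.of_forall laguerreSeq_zero) laguerre product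
  have u_eq := freeCumulant_unique m u fun n hn =>
    tendsto_nhds_unique (hm n hn).tendsto (hasExpansion_rootMoment hp hu hn).tendsto
  exact ⟨u', fun n hn => u_eq n hn ▸ hu n hn⟩

theorem hasExpansion_finiteCumulant_mulConv {p q : ℕ → ℝ[X]}
    (hp : ∀ᶠ d in atTop, IsMonicOfDegree (p d) d) (hq : ∀ᶠ d in atTop, IsMonicOfDegree (q d) d)
    {m k r s : ℕ → ℝ}
    (hr : ∀ n, 1 ≤ n → HasExpansion (fun d => finiteCumulant d (p d) n) (freeCumulant m n) (r n))
    (hs : ∀ n, 1 ≤ n → HasExpansion (fun d => finiteCumulant d (q d) n) (freeCumulant k n) (s n))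
    {n : ℕ} (hn : 1 ≤ n) :
    HasExpansion (fun d => finiteCumulant d (mulConv d (p d) (q d)) n)
      (freeCumulant (freeMulConv m k) n)
      (mulFluctuation (freeCumulant m) r (freeCumulant k) s n) := by
  simp only [finiteCumulant_eq_seqCumulant, normCoeff_mulConv, freeCumulant_freeMulConv m k hn]
  exact hasExpansion_seqCumulant_mul (hp.mono fun d => normCoeff_zero)
    (hq.mono fun d => normCoeff_zero) hr hs hn

theorem exists_hasInfinitesimalDistribution {p : ℕ → ℝ[X]}
    (hp : ∀ᶠ d in atTop, IsMonicOfDegree (p d) d) {τ : Measure ℝ} (hτ : IsProbWithMoments τ)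
    {m' : ℕ → ℝ}
    (hm : ∀ n, 1 ≤ n → HasExpansion (fun d => rootMoment d (p d) n) (moments τ n) (m' n)) :
    ∃ τ' : ℝ[X] →ₗ[ℝ] ℝ, HasInfinitesimalDistribution p τ τ' ∧ ∀ n, 1 ≤ n → τ' (X ^ n) = m' n := by
  have := hτ.1
  obtain ⟨τ', hτ'⟩ : ∃ τ' : ℝ[X] →ₗ[ℝ] ℝ, ∀ n, τ' (X ^ n) = if n = 0 then 0 else m' n :=
    ⟨(basisMonomials ℝ).constr ℝ fun n => if n = 0 then 0 else m' n, fun n => by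
      simpa [← X_pow_eq_monomial] using
        (basisMonomials ℝ).constr_basis ℝ (fun n => if n = 0 then 0 else m' n) n⟩
  have expansion (n : ℕ) :
      HasExpansion (fun d => rootMoment d (p d) n) (moments τ n) (τ' (X ^ n)) := by
    rw [hτ']
    rcases Nat.eq_zero_or_pos n with rfl | hn
    · refine (HasExpansion.const (moments τ 0)).congr' ?_
      filter_upwards [hp, eventually_ne_atTop 0] with d monic hd
      simp [moments, rootMoment_zero hd monic]
    · rw [if_neg hn.ne']
      exact hm n hn
  exact ⟨τ', ⟨hτ, fun n => (expansion n).tendsto, expansion⟩,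
    fun n hn => (hτ' n).trans (if_neg (Nat.one_le_iff_ne_zero.1 hn))⟩

end FiniteFree

open FiniteFree in
theorem mainTheorem2_general {p q : ℕ → ℝ[X]} (hp : ∀ᶠ d in atTop, IsMonicOfDegree (p d) d)
    (hq : ∀ᶠ d in atTop, IsMonicOfDegree (q d) d) {m m' k k' : ℕ → ℝ}
    (hm : ∀ n, 1 ≤ n → HasExpansion (fun d => rootMoment d (p d) n) (m n) (m' n))
    (hk : ∀ n, 1 ≤ n → HasExpansion (fun d => rootMoment d (q d) n) (k n) (k' n)) :
    ∃ rp rq rpq mpq : ℕ → ℝ,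
      HasCumulantFluctuations p m rp ∧
      HasCumulantFluctuations q k rq ∧
      (∀ n, 1 ≤ n → rpq n = mulFluctuation (freeCumulant m) rp (freeCumulant k) rq n) ∧
      (∀ n, 1 ≤ n → mpq n = infinitesimalMoment (freeCumulant (freeMulConv m k)) rpq n) ∧
      HasCumulantFluctuations (fun d => mulConv d (p d) (q d)) (freeMulConv m k) rpq ∧
      (∀ n, 1 ≤ n →
        HasExpansion (fun d => rootMoment d (mulConv d (p d) (q d)) n)
          (freeMulConv m k n) (mpq n)) ∧
      ∀ τ : Measure ℝ,
        IsProbWithMoments τ ∧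
          (∀ n, 1 ≤ n → freeCumulant (moments τ) n = freeMulConvCumulant m k n) →
        HasCumulantFluctuations (fun d => mulConv d (p d) (q d)) (moments τ) rpq ∧
        ∃ τ' : ℝ[X] →ₗ[ℝ] ℝ,
          HasInfinitesimalDistribution (fun d => mulConv d (p d) (q d)) τ τ' ∧
          ∀ n, 1 ≤ n → τ' (X ^ n) = mpq n := by
  obtain ⟨rp, hrp⟩ := exists_hasExpansion_finiteCumulant hp hm
  obtain ⟨rq, hrq⟩ := exists_hasExpansion_finiteCumulant hq hk
  have monic := (hp.and hq).mono fun d h => isMonicOfDegree_mulConv h.1 h.2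
  have cumulants n (hn : 1 ≤ n) := hasExpansion_finiteCumulant_mulConv hp hq hrp hrq hn
  have product_moments n (hn : 1 ≤ n) :
      HasExpansion (fun d => rootMoment d (mulConv d (p d) (q d)) n) (freeMulConv m k n) _ :=
    moment_eq_sum_freeCumulant (freeMulConv m k) hn ▸ hasExpansion_rootMoment monic cumulants hn
  refine ⟨rp, rq, _, _, fun n hn => HasExpansion.isLittleO_iff.2 (hrp n hn),
    fun n hn => HasExpansion.isLittleO_iff.2 (hrq n hn), fun _ _ => rfl, fun _ _ => rfl,
    fun n hn => HasExpansion.isLittleO_iff.2 (cumulants n hn), product_moments, ?_⟩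
  rintro τ ⟨hτ, cumulants_τ⟩
  have cumulants_eq n (hn : 1 ≤ n) :
      freeCumulant (moments τ) n = freeCumulant (freeMulConv m k) n :=
    (cumulants_τ n hn).trans (freeCumulant_freeMulConv m k hn).symm
  exact ⟨fun n hn => HasExpansion.isLittleO_iff.2 (cumulants_eq n hn ▸ cumulants n hn),
    exists_hasInfinitesimalDistribution monic hτ fun n hn =>
      eq_of_freeCumulant_eq cumulants_eq hn ▸ product_moments n hn⟩

theorem mainTheorem2 (p q : ℕ → Polynomial ℝ)
    (hp : ∀ d, 1 ≤ d → FiniteFree.IsRealRooted d (p d))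
    (hq : ∀ d, 1 ≤ d → FiniteFree.IsRealRooted d (q d))
    (μ ν : MeasureTheory.Measure ℝ) (μ' ν' : Polynomial ℝ →ₗ[ℝ] ℝ)
    (hμ : FiniteFree.HasInfinitesimalDistribution p μ μ')
    (hν : FiniteFree.HasInfinitesimalDistribution q ν ν') :
    -- `rp`, `rq`, `rpq`: cumulant fluctuations of the two sequences and of their product;
    -- `mpq`: infinitesimal moments of the product (all unique for indices `n ≥ 1`)
    ∃ rp rq rpq mpq : ℕ → ℝ,
      FiniteFree.HasCumulantFluctuations p (FiniteFree.moments μ) rp ∧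
      FiniteFree.HasCumulantFluctuations q (FiniteFree.moments ν) rq ∧
      (∀ n : ℕ, 1 ≤ n → rpq n =
        FiniteFree.mulFluctuation
          (FiniteFree.freeCumulant (FiniteFree.moments μ)) rp
          (FiniteFree.freeCumulant (FiniteFree.moments ν)) rq n) ∧
      (∀ n : ℕ, 1 ≤ n → mpq n =
        FiniteFree.infinitesimalMoment
          (FiniteFree.freeCumulant
            (FiniteFree.freeMulConv (FiniteFree.moments μ) (FiniteFree.moments ν))) rpq n) ∧
      -- the expansions of the product, relative to the moment sequence of `μ ⊠ ν`
      FiniteFree.HasCumulantFluctuations (fun d => FiniteFree.mulConv d (p d) (q d))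
        (FiniteFree.freeMulConv (FiniteFree.moments μ) (FiniteFree.moments ν)) rpq ∧
      (∀ n : ℕ, 1 ≤ n →
        Filter.Tendsto
          (fun d : ℕ =>
            (d : ℝ) * (FiniteFree.rootMoment d (FiniteFree.mulConv d (p d) (q d)) n -
              FiniteFree.freeMulConv (FiniteFree.moments μ) (FiniteFree.moments ν) n))
          Filter.atTop (nhds (mpq n))) ∧
      -- the same relative to a probability measure `τ = μ ⊠ ν`
      (∀ τ : MeasureTheory.Measure ℝ, FiniteFree.IsFreeMulConv μ ν τ →
        FiniteFree.HasCumulantFluctuations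
          (fun d => FiniteFree.mulConv d (p d) (q d)) (FiniteFree.moments τ) rpq ∧
        ∃ τ' : Polynomial ℝ →ₗ[ℝ] ℝ,
          FiniteFree.HasInfinitesimalDistribution
            (fun d => FiniteFree.mulConv d (p d) (q d)) τ τ' ∧
          ∀ n : ℕ, 1 ≤ n → τ' (Polynomial.X ^ n) = mpq n) := by
  have monic {r : ℕ → ℝ[X]} (hr : ∀ d, 1 ≤ d → FiniteFree.IsRealRooted d (r d)) :
      ∀ᶠ d in atTop, IsMonicOfDegree (r d) d := by
    filter_upwards [eventually_ge_atTop 1] with d hd using ⟨(hr d hd).2.1, (hr d hd).1⟩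
  exact mainTheorem2_general (monic hp) (monic hq)
    (fun n _ => hμ.infinitesimal n) (fun n _ => hν.infinitesimal n)
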